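/- Let $G\subseteq K_{m,n}$ be a connected bipartite graph with vertex classes $U_1$ ($|U_1|=m$) and $U_2$ ($|U_2|=n$). Let $M_{\mathbb Q}=\{x\in\mathbb Q^{m+n} : \sum_{v\in U_1}x_v=\sum_{v\in U_2}x_v\}$ and $N_{\mathbb Q}=\mathbb Q^{m+n}/\langle(1,\dots,1,-1,\dots,-1)\rangle$ with the induced pairing. Let $\sigma_G^\vee\subseteq M_{\mathbb Q}$ be the cone generated by the vectors $e^i+f^j$ for the edges $(i,j)$ of $G$ (with $i\in U_1$, $j\in U_2$), and let $\sigma_G\subseteq N_{\mathbb Q}$ be its dual cone (the edge cone). An independent set is a nonempty set of vertices containing no two adjacent ones; write $A_i=A\cap U_i$ and let $N(A)$ be the set of neighbours of $A$. It is two-sided if $\emptyset\ne A_1\subsetneq U_1$ and $\emptyset\neq A_2\subsetneq U_2$. Let $\mathcal I_G^{(*)}$ consist of the two-sided maximal independent sets and of the independent sets $U_i\setminus\{u\}$ that are not contained in any two-sided independent set. For $A\in\mathcal I_G^{(*)}$ let $G\{A\}$ be the spanning subgraph of $G$ whose edges are those of $G[A_1\sqcup N(A_1)]$ and of $G[A_2\sqcup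 N(A_2)]$ if $A$ is two-sided, and those of $G[A\sqcup N(A)]$ and of $G[(U_i\setminus A)\sqcup(U_j\setminus N(A))]$, $\{i,j\}=\{1,2\}$, if $A\subseteq U_i$. The first independent sets are the $A\in\mathcal I_G^{(*)}$ for which $G\{A\}$ has exactly two connected components; their set is $\mathcal I_G^{(1)}$. To $A\in\mathcal I_G^{(1)}$ one associates the extremal ray $\mathfrak a=\pi(A)=(\mathcal H_{A_i}\cap\sigma_G^\vee)^\perp\cap\sigma_G$ of $\sigma_G$, where $A_i\neq\emptyset$ and $\mathcal H_{A_i}=\{x\in M_{\mathbb Q}:\sum_{v\in A_i}x_v=\sum_{v\in N(A_i)}x_v\}$. A tuple of pairwise distinct first independent sets belongs to $\mathcal I_G^{(d)}$ if the associated extremal rays are the extremal rays of, and span, a $d$-dimensional face of $\sigma_G$; we say that the tuple forms this face. Let $C=C_1\sqcup C_2$ and $C'=C'_1\sqcup C'_2$ be two-sided first independent sets with $(C,C')\notin\mathcal I_G^{(2)}$, and let $\tau$ be a three-dimensional face of $\sigma_G$ having $\mathfrak c=\pi(C)$ and $\mathfrak c'=\pi(C')$ among its extremal rays. 1. (Type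 (ii)) If $C_1\cap C_1'=\emptyset$ and $C_2\cap C_2'=\emptyset$, then one of the following holds: * there are $A=U_1\setminus\{a\}$ and $A'=U_1\setminus\{a'\}$ in $\mathcal I_G^{(1)}$ with $(A,A')\notin\mathcal I_G^{(2)}$, $C_1\sqcup C_1'=A\cap A'$ and $C_2\sqcup C_2'=U_2$, and $\tau$ is formed by $(A,A',C,C')\in\mathcal I_G^{(3)}$; or symmetrically, there are $B=U_2\setminus\{b\}$ and $B'=U_2\setminus\{b'\}$ in $\mathcal I_G^{(1)}$ with $(B,B')\notin\mathcal I_G^{(2)}$, $C_1\sqcup C_1'=U_1$ and $C_2\sqcup C_2'=B\cap B'$, and $\tau$ is formed by $(B,B',C,C')\in\mathcal I_G^{(3)}$; * there are $A=U_1\setminus\{a\}$ and $B=U_2\setminus\{b\}$ in $\mathcal I_G^{(1)}$ with $(A,B)\notin\mathcal I_G^{(2)}$, $C_1\sqcup C_1'=A$ and $C_2\sqcup C_2'=B$, and $\tau$ is formed by $(A,B,C,C')\in\mathcal I_G^{(3)}$. 2. (Type (iii)) If $C_1\cap C_1'\ne\emptyset$ and $C_2\cap C_2'=\emptyset$, then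 one of the following holds: * (i) $\tau$ is formed by $(A,C,C',C'')\in\mathcal I_G^{(3)}$, where $A=C_1\cup C_1'\in\mathcal I_G^{(1)}$ is of the form $U_1\setminus\{a\}$ and $C''=(C_1\cap C_1')\sqcup(C_2\sqcup C_2')\in\mathcal I_G^{(1)}$; * (ii) $C_1\cup C_1'=U_1$ and $\tau$ is formed by $(C,C',\mathcal C,\mathcal C')\in\mathcal I_G^{(3)}$ for some two-sided $\mathcal C,\mathcal C'\in\mathcal I_G^{(1)}$ with $\mathcal C_1\sqcup\mathcal C_1'=C_1\cap C_1'$ (disjoint union), $\mathcal C_2\cap\mathcal C_2'=C_2\sqcup C_2'$ and $\mathcal C_2\cup\mathcal C_2'=U_2$; * (iii) $C_1\cup C_1'=U_1$ and there is $b\in U_2\setminus(C_2\sqcup C_2')$ such that $\tau$ is formed by $(B,C,C',C'')\in\mathcal I_G^{(3)}$, where $B=U_2\setminus\{b\}\in\mathcal I_G^{(1)}$ and $C''=(C_1\cap C_1')\sqcup(C_2\sqcup C_2')\sqcup\{b\}\in\mathcal I_G^{(1)}$. 3. (Type (v)) If, for $i=1$ and $i=2$, $C_i\cap C_i'$ is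 nonempty and different from both $C_i$ and $C_i'$, then $\mathcal C=(C_1\cap C_1')\sqcup(C_2\cup C_2')$ and $\mathcal C'=(C_1\cup C_1')\sqcup(C_2\cap C_2')$ are first independent sets, and $\tau$ is formed by $(C,C',\mathcal C,\mathcal C')\in\mathcal I_G^{(3)}$. -/

import Mathlib

open Set

noncomputable section

namespace EdgeCone

/-- The vector `(1,-1) ∈ ℚ^{m+n}`: `1` on `U₁` and `-1` on `U₂`. -/
def oneNegOne (U₁ U₂ : Type*) : U₁ ⊕ U₂ → ℚ := Sum.elim (fun _ => 1) (fun _ => -1)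

/-- `N_ℚ = ℚ^{m+n} / ⟨(1,-1)⟩`. -/
abbrev NSpace (U₁ U₂ : Type*) : Type _ :=
  (U₁ ⊕ U₂ → ℚ) ⧸ Submodule.span ℚ {oneNegOne U₁ U₂}

/-- The standard bilinear form on `ℚ^{m+n}`. -/
def dotForm (U₁ U₂ : Type*) [Fintype U₁] [Fintype U₂] :
    (U₁ ⊕ U₂ → ℚ) →ₗ[ℚ] (U₁ ⊕ U₂ → ℚ) →ₗ[ℚ] ℚ :=
  LinearMap.mk₂ ℚ (fun x y => ∑ v, x v * y v)
    (fun x x' y => by simp only [Pi.add_apply, add_mul, Finset.sum_add_distrib])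
    (fun c x y => by simp only [Pi.smul_apply, smul_eq_mul, Finset.mul_sum, mul_assoc])
    (fun x y y' => by simp only [Pi.add_apply, mul_add, Finset.sum_add_distrib])
    (fun c x y => by
      simp only [Pi.smul_apply, smul_eq_mul, Finset.mul_sum, mul_left_comm])

/-- `M_ℚ = ℚ^{m+n} ∩ (1,-1)^⊥`. -/
def MSpace (U₁ U₂ : Type*) [Fintype U₁] [Fintype U₂] : Submodule ℚ (U₁ ⊕ U₂ → ℚ) :=
  LinearMap.ker (dotForm U₁ U₂ (oneNegOne U₁ U₂))

/-- The pairing `⟨·,·⟩ : M_ℚ × N_ℚ → ℚ` induced by the standard bilinear form. -/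
def pairing (U₁ U₂ : Type*) [Fintype U₁] [Fintype U₂] :
    MSpace U₁ U₂ →ₗ[ℚ] NSpace U₁ U₂ →ₗ[ℚ] ℚ :=
  LinearMap.flip <|
    (Submodule.span ℚ {oneNegOne U₁ U₂}).liftQ
      ((dotForm U₁ U₂).compl₂ (MSpace U₁ U₂).subtype) <| by
        rw [Submodule.span_le]
        rintro x rfl
        ext ⟨y, hy⟩
        exact hy

open Classical in
/-- The vector `e^i + f^j ∈ M_ℚ`. -/
def edgeVec {U₁ U₂ : Type*} [Fintype U₁] [Fintype U₂] (i : U₁) (j : U₂) : MSpace U₁ U₂ :=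
  ⟨Pi.single (Sum.inl i) 1 + Pi.single (Sum.inr j) 1, by
    simp [MSpace, dotForm, oneNegOne, Pi.single_apply]⟩

section Cones

variable {U₁ U₂ : Type*} [Fintype U₁] [Fintype U₂]

/-- The dual edge cone `σ_G^∨ ⊆ M_ℚ`, generated by the `e^i + f^j` for the edges `(i,j)` of `G`. -/
def dualEdgeCone (G : SimpleGraph (U₁ ⊕ U₂)) : PointedCone ℚ (MSpace U₁ U₂) :=
  PointedCone.hull ℚ {x | ∃ i j, G.Adj (Sum.inl i) (Sum.inr j) ∧ x = edgeVec i j}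

/-- The edge cone `σ_G ⊆ N_ℚ`. -/
def edgeCone (G : SimpleGraph (U₁ ⊕ U₂)) : PointedCone ℚ (NSpace U₁ U₂) :=
  PointedCone.dual (pairing U₁ U₂) (dualEdgeCone G : Set (MSpace U₁ U₂))

/-- The dimension of a cone: the dimension of its linear span. -/
def coneDim (τ : PointedCone ℚ (NSpace U₁ U₂)) : ℕ :=
  Module.finrank ℚ (Submodule.span ℚ (τ : Set (NSpace U₁ U₂)))

/-- The extremal rays of a (strongly convex) cone: its one-dimensional faces. -/
def extremalRays (τ : PointedCone ℚ (NSpace U₁ U₂)) : Set (PointedCone ℚ (NSpace U₁ U₂)) :=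
  {ρ | ρ.IsFaceOf τ ∧ coneDim ρ = 1}

end Cones

section Graphs

variable {U₁ U₂ : Type*}

/-- The vertex class `U₁` as a set of vertices. -/
def side₁ (U₁ U₂ : Type*) : Set (U₁ ⊕ U₂) := range Sum.inl

/-- The vertex class `U₂` as a set of vertices. -/
def side₂ (U₁ U₂ : Type*) : Set (U₁ ⊕ U₂) := range Sum.inr

/-- `A₁ = A ∩ U₁`. -/
def part₁ (A : Set (U₁ ⊕ U₂)) : Set (U₁ ⊕ U₂) := A ∩ side₁ U₁ U₂

/-- `A₂ = A ∩ U₂`. -/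
def part₂ (A : Set (U₁ ⊕ U₂)) : Set (U₁ ⊕ U₂) := A ∩ side₂ U₁ U₂

/-- `U₁ ∖ {a}`. -/
def coSingle₁ (U₂ : Type*) {U₁ : Type*} (a : U₁) : Set (U₁ ⊕ U₂) := side₁ U₁ U₂ \ {Sum.inl a}

/-- `U₂ ∖ {b}`. -/
def coSingle₂ (U₁ : Type*) {U₂ : Type*} (b : U₂) : Set (U₁ ⊕ U₂) := side₂ U₁ U₂ \ {Sum.inr b}

variable (G : SimpleGraph (U₁ ⊕ U₂))

/-- The neighbor set `N(A)`. -/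
def nbr (A : Set (U₁ ⊕ U₂)) : Set (U₁ ⊕ U₂) := {v | ∃ a ∈ A, G.Adj a v}

/-- Independent sets are nonempty and contain no adjacent vertices. -/
def IsIndep (A : Set (U₁ ⊕ U₂)) : Prop := A.Nonempty ∧ G.IsIndepSet A

/-- Two-sided independent sets: `∅ ≠ A₁ ⊊ U₁` and `∅ ≠ A₂ ⊊ U₂`. -/
def IsTwoSided (A : Set (U₁ ⊕ U₂)) : Prop :=
  IsIndep G A ∧ (part₁ A).Nonempty ∧ part₁ A ⊂ side₁ U₁ U₂ ∧
    (part₂ A).Nonempty ∧ part₂ A ⊂ side₂ U₁ U₂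

/-- Two-sided maximal independent sets. -/
def IsTwoSidedMaximal (A : Set (U₁ ⊕ U₂)) : Prop :=
  IsTwoSided G A ∧ Maximal (IsIndep G) A

/-- One-sided independent sets `U_i ∖ {u}` not contained in any two-sided independent set. -/
def IsOneSidedStar (A : Set (U₁ ⊕ U₂)) : Prop :=
  IsIndep G A ∧ ((∃ a, A = coSingle₁ U₂ a) ∨ (∃ b, A = coSingle₂ U₁ b)) ∧
    ∀ A', IsTwoSided G A' → ¬ A ⊆ A'

/-- The spanning subgraph of `G` with the edges of `G[X]` and of `G[Y]`. -/
def twoBlock (X Y : Set (U₁ ⊕ U₂)) : SimpleGraph (U₁ ⊕ U₂) :=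
  (G.induce X).spanningCoe ⊔ (G.induce Y).spanningCoe

open Classical in
/-- The associated bipartite subgraph `G{A}` of an independent set `A`, a spanning subgraph. -/
def assocGraph (A : Set (U₁ ⊕ U₂)) : SimpleGraph (U₁ ⊕ U₂) :=
  if A ⊆ side₁ U₁ U₂ then
    twoBlock G (A ∪ nbr G A) ((side₁ U₁ U₂ \ A) ∪ (side₂ U₁ U₂ \ nbr G A))
  else if A ⊆ side₂ U₁ U₂ then
    twoBlock G (A ∪ nbr G A) ((side₂ U₁ U₂ \ A) ∪ (side₁ U₁ U₂ \ nbr G A))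
  else
    twoBlock G (part₁ A ∪ nbr G (part₁ A)) (part₂ A ∪ nbr G (part₂ A))

/-- First independent sets: members `A` of `I_G^{(*)}` such that `G{A}` has exactly two
connected components. -/
def IsFirst (A : Set (U₁ ⊕ U₂)) : Prop :=
  (IsTwoSidedMaximal G A ∨ IsOneSidedStar G A) ∧
    Nat.card (assocGraph G A).ConnectedComponent = 2

/-- Type (ii): `C₁ ∩ C'₁ = ∅` and `C₂ ∩ C'₂ = ∅`. -/
def TypeII (C C' : Set (U₁ ⊕ U₂)) : Prop :=
  part₁ C ∩ part₁ C' = ∅ ∧ part₂ C ∩ part₂ C' = ∅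

/-- Type (iii): `C₁ ∩ C'₁ ≠ ∅` and `C₂ ∩ C'₂ = ∅`. -/
def TypeIII (C C' : Set (U₁ ⊕ U₂)) : Prop :=
  part₁ C ∩ part₁ C' ≠ ∅ ∧ part₂ C ∩ part₂ C' = ∅

/-- Type (v): in each `U_i` the two parts meet and neither contains the other. -/
def TypeV (C C' : Set (U₁ ⊕ U₂)) : Prop :=
  (part₁ C ∩ part₁ C' ≠ ∅ ∧ part₁ C ∩ part₁ C' ≠ part₁ C ∧ part₁ C ∩ part₁ C' ≠ part₁ C') ∧
  (part₂ C ∩ part₂ C' ≠ ∅ ∧ part₂ C ∩ part₂ C' ≠ part₂ C ∧ part₂ C ∩ part₂ C' ≠ part₂ C')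

end Graphs

section Rays

variable {U₁ U₂ : Type*} [Fintype U₁] [Fintype U₂] (G : SimpleGraph (U₁ ⊕ U₂))

/-- The supporting hyperplane `H_A = {x ∈ M_ℚ | ∑_{v ∈ A} x_v = ∑_{v ∈ N(A)} x_v}`. -/
def suppHyperplane (A : Set (U₁ ⊕ U₂)) : Set (MSpace U₁ U₂) :=
  {x | ∑ v, A.indicator x.1 v = ∑ v, (nbr G A).indicator x.1 v}

/-- For `F ⊆ σ_G^∨`, the cone `F^* = F^⊥ ∩ σ_G`. -/
def dualFace (F : Set (MSpace U₁ U₂)) : PointedCone ℚ (NSpace U₁ U₂) :=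
  edgeCone G ⊓ PointedCone.ofSubmodule (⨅ m ∈ F, LinearMap.ker (pairing U₁ U₂ m))

open Classical in
/-- The map `π : A ↦ 𝔞 = (H_{A_i} ∩ σ_G^∨)^*`, where `A_i ≠ ∅` is a part of `A`. -/
def ray (A : Set (U₁ ⊕ U₂)) : PointedCone ℚ (NSpace U₁ U₂) :=
  dualFace G (suppHyperplane G (if (part₁ A).Nonempty then part₁ A else part₂ A) ∩
    (dualEdgeCone G : Set (MSpace U₁ U₂)))

/-- The tuple `I` of pairwise distinct first independent sets forms the `d`-dimensional face `τ`
of `σ_G`: the associated rays are extremal rays of `τ` and span `τ`. -/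
def FormsFace (d : ℕ) {t : ℕ} (I : Fin t → Set (U₁ ⊕ U₂))
    (τ : PointedCone ℚ (NSpace U₁ U₂)) : Prop :=
  Function.Injective I ∧ (∀ k, IsFirst G (I k)) ∧
    τ.IsFaceOf (edgeCone G) ∧ coneDim τ = d ∧
    (∀ k, ray G (I k) ∈ extremalRays τ) ∧ τ = ⨆ k, ray G (I k)

/-- `I ∈ I_G^{(d)}`: the tuple `I` forms a `d`-dimensional face of `σ_G`. -/
def MemFaceTuples (d : ℕ) {t : ℕ} (I : Fin t → Set (U₁ ⊕ U₂)) : Prop :=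
  ∃ τ, FormsFace G d I τ

end Rays

end EdgeCone

end

/-! After a sign change on `U₂`, points of `N_ℚ` are potentials on the vertices modulo constants,
and the edge cone consists of the potentials `x` with `x j ≤ x i` on every edge `(i, j)`. Replacing
`A` by `toggle A` turns two-sided first independent sets into up-sets `F` such that `F` and `Fᶜ` are
both connected (`IsFirst.isSplit`; `IsSplit.isFirst` goes back and also covers the one-sided sets).
The ray of such a set is spanned by the indicator of `F` (`mem_ray_toggle_iff`).

On a face `τ`, call an edge tight if every potential in `τ` is constant along it. Every potential
constant along tight edges lies in the span of `τ`, so the tight graph has at most `coneDim τ + 1`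
components. When the dimension is three, any partition into four nonempty parts closed under tight
edges therefore has connected parts (`isConnSet_tightGraph_of_coneDim_eq_three`), and points of `τ`
have only four values.

Given `F` and `F'` in `τ`, such a partition exists in each of three situations: crossing, with parts
`F ∩ F'`, `F \ F'`, `F' \ F`, `(F ∪ F')ᶜ`; disjoint, with parts `F`, `F'` and two pieces of `(F ∪
F')ᶜ`; covering, with parts `Fᶜ`, `F'ᶜ` and two pieces of `F ∩ F'`. In the last two the pieces exist
because otherwise `F` and `F'` would form a two-dimensional face. Each time two further up-sets `P`,
`P'` satisfy `vec P + vec P' = vec F + vec F'`, and `τ` is the cone over a quadrilateral with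
diagonals `{F, F'}` and `{P, P'}` (`formsFace_toggle_four`).

The types (ii), (iii), (v) decide which situation occurs. One-sided sets arise because a connected
set inside a single vertex class is a single vertex. -/

noncomputable section

namespace EdgeCone

/-! ### Potentials as coordinates on `N_ℚ`. -/

section Potentials

variable {U₁ U₂ : Type*}

/-- The class in `N_ℚ` of the vector which is `x` on `U₁` and `-x` on `U₂`. -/
def ofPot (U₁ U₂ : Type*) : (U₁ ⊕ U₂ → ℚ) →ₗ[ℚ] NSpace U₁ U₂ :=
  (Submodule.span ℚ {oneNegOne U₁ U₂}).mkQ ∘ₗ LinearMap.mulLeft ℚ (oneNegOne U₁ U₂)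

lemma oneNegOne_mul_self : oneNegOne U₁ U₂ * oneNegOne U₁ U₂ = 1 := by
  ext (i | j) <;> simp [oneNegOne]

lemma ofPot_mul_oneNegOne (y : U₁ ⊕ U₂ → ℚ) :
    ofPot U₁ U₂ (oneNegOne U₁ U₂ * y) = Submodule.Quotient.mk y := by
  simp [ofPot, ← mul_assoc, oneNegOne_mul_self]

lemma ofPot_surjective : Function.Surjective (ofPot U₁ U₂) := by
  intro n
  obtain ⟨y, rfl⟩ := Submodule.Quotient.mk_surjective _ n
  exact ⟨_, ofPot_mul_oneNegOne y⟩

lemma ofPot_eq_zero_iff {x : U₁ ⊕ U₂ → ℚ} : ofPot U₁ U₂ x = 0 ↔ ∃ c, ∀ v, x v = c := by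
  simp only [ofPot, LinearMap.comp_apply, LinearMap.mulLeft_apply, Submodule.mkQ_apply,
    Submodule.Quotient.mk_eq_zero, Submodule.mem_span_singleton]
  constructor
  · rintro ⟨c, hc⟩
    refine ⟨c, fun v => ?_⟩
    have h := congrFun hc v
    rcases v with i | j <;> simp [oneNegOne] at h <;> linarith
  · rintro ⟨c, hc⟩
    refine ⟨c, ?_⟩
    ext v
    simp [hc, mul_comm]

lemma ofPot_eq_iff {x y : U₁ ⊕ U₂ → ℚ} :
    ofPot U₁ U₂ x = ofPot U₁ U₂ y ↔ ∃ c, ∀ v, x v = y v + c := by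
  rw [← sub_eq_zero, ← map_sub, ofPot_eq_zero_iff]
  simp only [Pi.sub_apply, sub_eq_iff_eq_add, add_comm]

/-- The class in `N_ℚ` of the indicator potential of a set of vertices. -/
def vec (F : Set (U₁ ⊕ U₂)) : NSpace U₁ U₂ := ofPot U₁ U₂ (F.indicator 1)

/-- Distinct sets give distinct rays: comparing potentials at a point of `P` and a point outside `P`
forces `c = 1`. The sign condition is essential, since complementary sets have opposite vectors. -/
lemma eq_of_vec_eq_smul {F P : Set (U₁ ⊕ U₂)} (hP : P.Nonempty) (hP' : Pᶜ.Nonempty) {c : ℚ}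
    (hc : 0 ≤ c) (h : vec P = c • vec F) : P = F := by
  classical
  rw [vec, vec, ← map_smul, ofPot_eq_iff] at h
  obtain ⟨d, hd⟩ := h
  obtain ⟨p, hp⟩ := hP
  obtain ⟨q, hq⟩ := hP'
  have h1 := hd p
  have h2 := hd q
  rw [mem_compl_iff] at hq
  simp only [Set.indicator, hp, hq, if_true, if_false, Pi.smul_apply, Pi.one_apply, smul_eq_mul]
    at h1 h2
  have hpF : p ∈ F := by
    by_contra hpF
    rw [if_neg hpF] at h1
    split_ifs at h2 <;> linarith
  have hqF : q ∉ F := by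
    intro hqF
    rw [if_pos hpF] at h1
    rw [if_pos hqF] at h2
    linarith
  rw [if_pos hpF] at h1
  rw [if_neg hqF] at h2
  ext v
  have h3 := hd v
  simp only [Set.indicator, Pi.smul_apply, Pi.one_apply, smul_eq_mul] at h3
  by_cases hvP : v ∈ P <;> by_cases hvF : v ∈ F <;>
    simp only [hvP, hvF, if_true, if_false] at h3 ⊢ <;> linarith

lemma vec_ne_zero {F : Set (U₁ ⊕ U₂)} (hF : F.Nonempty) (hF' : Fᶜ.Nonempty) : vec F ≠ 0 := by
  intro h
  rw [vec, ofPot_eq_zero_iff] at h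
  obtain ⟨c, hc⟩ := h
  obtain ⟨p, hp⟩ := hF
  obtain ⟨q, hq⟩ := hF'
  have h1 := hc p
  have h2 := hc q
  rw [Set.indicator_of_mem hp, Pi.one_apply] at h1
  rw [Set.indicator_of_notMem hq] at h2
  linarith

variable [Fintype U₁] [Fintype U₂]

lemma pairing_edgeVec_ofPot (i : U₁) (j : U₂) (x : U₁ ⊕ U₂ → ℚ) :
    pairing U₁ U₂ (edgeVec i j) (ofPot U₁ U₂ x) = x (Sum.inl i) - x (Sum.inr j) := by
  classical
  change ∑ v, (oneNegOne U₁ U₂ * x) v * (edgeVec i j).1 v = _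
  simp [edgeVec, oneNegOne, Pi.single_apply, sub_eq_add_neg]

variable (G : SimpleGraph (U₁ ⊕ U₂))

lemma pairing_nonneg {G : SimpleGraph (U₁ ⊕ U₂)} {n : NSpace U₁ U₂} (hn : n ∈ edgeCone G)
    {m : MSpace U₁ U₂} (hm : m ∈ dualEdgeCone G) : 0 ≤ pairing U₁ U₂ m n :=
  PointedCone.mem_dual.1 hn hm

lemma edgeVec_mem {G : SimpleGraph (U₁ ⊕ U₂)} {i : U₁} {j : U₂}
    (h : G.Adj (Sum.inl i) (Sum.inr j)) : edgeVec i j ∈ dualEdgeCone G :=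
  PointedCone.subset_hull ⟨i, j, h, rfl⟩

lemma mem_edgeCone_iff {n : NSpace U₁ U₂} : n ∈ edgeCone G ↔
    ∀ i j, G.Adj (Sum.inl i) (Sum.inr j) → 0 ≤ pairing U₁ U₂ (edgeVec i j) n := by
  rw [edgeCone, dualEdgeCone, PointedCone.dual_hull, PointedCone.mem_dual]
  constructor
  · intro h i j hij
    exact h ⟨i, j, hij, rfl⟩
  · rintro h _ ⟨i, j, hij, rfl⟩
    exact h i j hij

lemma ofPot_mem_edgeCone_iff {x : U₁ ⊕ U₂ → ℚ} : ofPot U₁ U₂ x ∈ edgeCone G ↔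
    ∀ i j, G.Adj (Sum.inl i) (Sum.inr j) → x (Sum.inr j) ≤ x (Sum.inl i) := by
  simp only [mem_edgeCone_iff, pairing_edgeVec_ofPot, sub_nonneg]

lemma mem_dualFace_iff {S : Set (MSpace U₁ U₂)} {n : NSpace U₁ U₂} :
    n ∈ dualFace G S ↔ n ∈ edgeCone G ∧ ∀ m ∈ S, pairing U₁ U₂ m n = 0 := by
  simp [dualFace, Submodule.mem_inf]

/-- Pairings with elements of `S` are nonnegative on the edge cone, so a sum on which they vanish
has vanishing terms. -/
lemma dualFace_isFaceOf {S : Set (MSpace U₁ U₂)} (hS : S ⊆ dualEdgeCone G) :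
    (dualFace G S).IsFaceOf (edgeCone G) where
  le n hn := ((mem_dualFace_iff G).1 hn).1
  mem_of_smul_add_mem := by
    intro x y a hx hy ha h
    rw [mem_dualFace_iff] at h ⊢
    refine ⟨hx, fun m hm => ?_⟩
    have h1 := h.2 m hm
    rw [map_add, map_smul, smul_eq_mul] at h1
    have h2 := pairing_nonneg hx (hS hm)
    have h3 := pairing_nonneg hy (hS hm)
    have h4 := mul_nonneg ha.le h2
    have h5 : a * pairing U₁ U₂ m x = 0 := by linarith
    exact (mul_eq_zero.1 h5).resolve_left ha.ne'

/-- An element `n` of `N_ℚ` vanishing on all edge vectors on which `h ∈ σ_G` vanishes is dominated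
by a multiple of `h`. -/
lemma exists_smul_sub_mem {h n : NSpace U₁ U₂} (hh : h ∈ edgeCone G)
    (hz : ∀ i j, G.Adj (Sum.inl i) (Sum.inr j) → pairing U₁ U₂ (edgeVec i j) h = 0 →
      pairing U₁ U₂ (edgeVec i j) n = 0) :
    ∃ K : ℚ, 0 ≤ K ∧ K • h - n ∈ edgeCone G := by
  -- `K` has to exceed every ratio of the two pairings. Summing absolute values over all pairs does
  -- this at once; a zero denominator contributes `0`.
  let q : U₁ × U₂ → ℚ := fun p =>
    |pairing U₁ U₂ (edgeVec p.1 p.2) n / pairing U₁ U₂ (edgeVec p.1 p.2) h|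
  refine ⟨∑ p, q p, Finset.sum_nonneg fun p _ => abs_nonneg _, ?_⟩
  rw [mem_edgeCone_iff]
  intro i j hij
  rw [map_sub, map_smul, smul_eq_mul, sub_nonneg]
  have h0 := (mem_edgeCone_iff G).1 hh i j hij
  rcases h0.eq_or_lt with h1 | h1
  · rw [hz i j hij h1.symm, ← h1, mul_zero]
  · have h2 : q (i, j) ≤ ∑ p, q p :=
      Finset.single_le_sum (fun p _ => abs_nonneg _) (Finset.mem_univ (i, j))
    have h3 : pairing U₁ U₂ (edgeVec i j) n / pairing U₁ U₂ (edgeVec i j) h ≤ q (i, j) :=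
      le_abs_self _
    exact (div_le_iff₀ h1).1 (h3.trans h2)

end Potentials

/-! ### Connected vertex sets and connected components. -/

section Connected

variable {V : Type*}

/-- A nonempty set of vertices without a nonempty proper subset closed under adjacency. -/
def IsConnSet (G : SimpleGraph V) (S : Set V) : Prop :=
  S.Nonempty ∧ ∀ A ⊆ S, A.Nonempty → (∀ v ∈ A, ∀ w ∈ S, G.Adj v w → w ∈ A) → A = S

lemma IsConnSet.mono {G H : SimpleGraph V} (hGH : G ≤ H) {S : Set V} (h : IsConnSet G S) :
    IsConnSet H S :=
  ⟨h.1, fun A hA hne hcl => h.2 A hA hne fun v hv w hw hvw => hcl v hv w hw (hGH hvw)⟩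

lemma IsConnSet.eq_of_forall_adj {G : SimpleGraph V} {S : Set V} (h : IsConnSet G S) {α : Type*}
    {x : V → α} (hx : ∀ v ∈ S, ∀ w ∈ S, G.Adj v w → x v = x w) {v w : V} (hv : v ∈ S)
    (hw : w ∈ S) : x v = x w := by
  have h1 := h.2 {u ∈ S | x v = x u} (fun u hu => hu.1) ⟨v, hv, rfl⟩
    (fun u hu u' hu' huu => ⟨hu', hu.2.trans (hx u hu.1 u' hu' huu)⟩)
  rw [← h1] at hw
  exact hw.2

lemma IsConnSet.exists_adj {G : SimpleGraph V} {S : Set V} (h : IsConnSet G S) {A : Set V}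
    (hA : A ⊆ S) (hne : A.Nonempty) (hS : (S \ A).Nonempty) :
    ∃ v ∈ A, ∃ w ∈ S \ A, G.Adj v w := by
  by_contra! hc
  have h1 := h.2 A hA hne fun v hv w hw hvw => by
    by_contra hwA
    exact hc v hv w ⟨hw, hwA⟩ hvw
  rw [h1, sdiff_self] at hS
  exact not_nonempty_empty hS

lemma IsConnSet.exists_adj_of_mem {G : SimpleGraph V} {S : Set V} (h : IsConnSet G S) {v w : V}
    (hv : v ∈ S) (hw : w ∈ S) (hvw : v ≠ w) : ∃ u ∈ S, G.Adj v u := by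
  obtain ⟨v', rfl, u, hu, hvu⟩ := h.exists_adj (singleton_subset_iff.2 hv) (singleton_nonempty v)
    ⟨w, hw, hvw.symm⟩
  exact ⟨u, hu.1, hvu⟩

lemma IsConnSet.union {G : SimpleGraph V} {S T : Set V} (hS : IsConnSet G S) (hT : IsConnSet G T)
    (h : (S ∩ T).Nonempty) : IsConnSet G (S ∪ T) := by
  obtain ⟨p, hpS, hpT⟩ := h
  refine ⟨⟨p, Or.inl hpS⟩, fun A hA hne hcl => ?_⟩
  have key : ∀ R : Set V, IsConnSet G R → R ⊆ S ∪ T → (A ∩ R).Nonempty → R ⊆ A := by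
    intro R hR hRS hAR
    have := hR.2 (A ∩ R) inter_subset_right hAR
      fun v hv w hw hvw => ⟨hcl v hv.1 w (hRS hw) hvw, hw⟩
    exact fun r hr => (this.symm ▸ hr : r ∈ A ∩ R).1
  have hp : p ∈ A := by
    obtain ⟨a, ha⟩ := hne
    rcases hA ha with haS | haT
    · exact key S hS subset_union_left ⟨a, ha, haS⟩ hpS
    · exact key T hT subset_union_right ⟨a, ha, haT⟩ hpT
  exact hA.antisymm (union_subset (key S hS subset_union_left ⟨p, hp, hpS⟩)
    (key T hT subset_union_right ⟨p, hp, hpT⟩))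

lemma isConnSet_pair {G : SimpleGraph V} {v w : V} (h : G.Adj v w) : IsConnSet G {v, w} := by
  refine ⟨⟨v, Or.inl rfl⟩, fun A hA hne hcl => hA.antisymm ?_⟩
  obtain ⟨a, ha⟩ := hne
  rcases hA ha with rfl | rfl
  · exact insert_subset ha (singleton_subset_iff.2 (hcl _ ha w (Or.inr rfl) h))
  · exact insert_subset (hcl _ ha v (Or.inl rfl) h.symm) (singleton_subset_iff.2 ha)

lemma IsConnSet.union_of_adj {G : SimpleGraph V} {S T : Set V} (hS : IsConnSet G S)
    (hT : IsConnSet G T) {v w : V} (hv : v ∈ S) (hw : w ∈ T) (h : G.Adj v w) :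
    IsConnSet G (S ∪ T) := by
  have h1 := (hS.union (isConnSet_pair h) ⟨v, hv, Or.inl rfl⟩).union hT
    ⟨w, Or.inr (Or.inr rfl), hw⟩
  convert h1 using 1
  ext u
  simp only [mem_union, mem_insert_iff, mem_singleton_iff]
  constructor
  · tauto
  · rintro ((h | rfl | rfl) | h) <;> tauto

/-- A disconnected set splits into two nonempty parts without edges in between. -/
lemma exists_split_of_not_isConnSet {G : SimpleGraph V} {S : Set V} (hne : S.Nonempty)
    (h : ¬ IsConnSet G S) : ∃ K L : Set V, K.Nonempty ∧ L.Nonempty ∧ Disjoint K L ∧ K ∪ L = S ∧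
      ∀ v ∈ K, ∀ w ∈ L, ¬ G.Adj v w := by
  simp only [IsConnSet, not_and, not_forall] at h
  obtain ⟨A, hA, hAne, hcl, hAS⟩ := h hne
  refine ⟨A, S \ A, hAne, ?_, disjoint_sdiff_right, union_sdiff_cancel hA, ?_⟩
  · exact nonempty_of_ssubset (hA.ssubset_of_ne hAS)
  · intro v hv w hw hvw
    exact hw.2 (hcl v hv w hw.1 hvw)

lemma isConnSet_univ {G : SimpleGraph V} (h : G.Connected) : IsConnSet G univ := by
  have hpre := h.preconnected
  refine ⟨h.nonempty.elim fun p => ⟨p, trivial⟩, fun A _ hne hcl => eq_univ_of_forall fun v => ?_⟩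
  obtain ⟨a, ha⟩ := hne
  obtain ⟨w⟩ := hpre a v
  induction w with
  | nil => exact ha
  | cons hadj _ ih => exact ih (hcl _ ha _ trivial hadj)

lemma IsConnSet.reachable {G : SimpleGraph V} {S : Set V} (h : IsConnSet G S) {v w : V}
    (hv : v ∈ S) (hw : w ∈ S) : G.Reachable v w := by
  have h1 := h.eq_of_forall_adj (x := G.connectedComponentMk)
    (fun a _ b _ hab => SimpleGraph.ConnectedComponent.sound hab.reachable) hv hw
  exact SimpleGraph.ConnectedComponent.exact h1

lemma eq_of_reachable {G : SimpleGraph V} {α : Type*} {x : V → α}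
    (hx : ∀ v w, G.Adj v w → x v = x w) {v w : V} (h : G.Reachable v w) : x v = x w := by
  obtain ⟨p⟩ := h
  induction p with
  | nil => rfl
  | cons hab _ ih => exact (hx _ _ hab).trans ih

/-- A colouring constant along edges factors through the components, and the resulting map is still
onto. -/
lemma card_le_card_connectedComponent [Finite V] {G : SimpleGraph V} {k : ℕ} {c : V → Fin k}
    (hc : Function.Surjective c) (hadj : ∀ v w, G.Adj v w → c v = c w) :
    k ≤ Nat.card G.ConnectedComponent := by
  let f : G.ConnectedComponent → Fin k :=
    SimpleGraph.ConnectedComponent.lift c fun v w p _ => eq_of_reachable hadj p.reachable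
  have hf : Function.Surjective f := fun y => by
    obtain ⟨v, rfl⟩ := hc y
    exact ⟨G.connectedComponentMk v, rfl⟩
  have : Finite G.ConnectedComponent := Quot.finite _
  simpa using Nat.card_le_card_of_surjective f hf

end Connected

/-! ### Independent sets as up-sets: the dictionary given by `toggle`. -/

section Splits

variable {U₁ U₂ : Type*}

@[simp] lemma inl_mem_side₁ (i : U₁) : Sum.inl i ∈ side₁ U₁ U₂ := mem_range_self i
@[simp] lemma inr_notMem_side₁ (j : U₂) : Sum.inr j ∉ side₁ U₁ U₂ := by simp [side₁]
@[simp] lemma inr_mem_side₂ (j : U₂) : Sum.inr j ∈ side₂ U₁ U₂ := mem_range_self j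
@[simp] lemma inl_notMem_side₂ (i : U₁) : Sum.inl i ∉ side₂ U₁ U₂ := by simp [side₂]

/-- The set which agrees with the complement of `A` on `U₁` and with `A` on `U₂`. It relates
independent sets to up-sets. -/
def toggle (A : Set (U₁ ⊕ U₂)) : Set (U₁ ⊕ U₂) := (side₁ U₁ U₂ \ A) ∪ (side₂ U₁ U₂ ∩ A)

@[simp] lemma inl_mem_toggle {A : Set (U₁ ⊕ U₂)} {i : U₁} :
    Sum.inl i ∈ toggle A ↔ Sum.inl i ∉ A := by simp [toggle]

@[simp] lemma inr_mem_toggle {A : Set (U₁ ⊕ U₂)} {j : U₂} :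
    Sum.inr j ∈ toggle A ↔ Sum.inr j ∈ A := by simp [toggle]

@[simp] lemma toggle_toggle (A : Set (U₁ ⊕ U₂)) : toggle (toggle A) = A := by
  ext (i | j) <;> simp

lemma toggle_injective : Function.Injective (toggle : Set (U₁ ⊕ U₂) → Set (U₁ ⊕ U₂)) :=
  fun A B h => by rw [← toggle_toggle A, h, toggle_toggle]

lemma part₁_toggle (F : Set (U₁ ⊕ U₂)) : part₁ (toggle F) = side₁ U₁ U₂ \ F := by
  ext (i | j) <;> simp [part₁]

lemma part₂_toggle (F : Set (U₁ ⊕ U₂)) : part₂ (toggle F) = side₂ U₁ U₂ ∩ F := by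
  ext (i | j) <;> simp [part₂]

/-- With `toggle_compl_singleton_inr`, this identifies the up-sets behind one-sided independent
sets: a single vertex of `U₁`, or the complement of a single vertex of `U₂`. -/
lemma toggle_singleton_inl (a : U₁) : toggle {Sum.inl a} = coSingle₁ U₂ a := by
  ext (i | j) <;> simp [coSingle₁]

lemma toggle_compl_singleton_inr (b : U₂) : toggle {Sum.inr b}ᶜ = coSingle₂ U₁ b := by
  ext (i | j) <;> simp [coSingle₂]

/-- An up-set of vertices which is connected and has a connected complement. -/
structure IsSplit (G : SimpleGraph (U₁ ⊕ U₂)) (F : Set (U₁ ⊕ U₂)) : Prop where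
  up : ∀ i j, G.Adj (Sum.inl i) (Sum.inr j) → Sum.inr j ∈ F → Sum.inl i ∈ F
  conn : IsConnSet G F
  conn_compl : IsConnSet G Fᶜ

variable {G : SimpleGraph (U₁ ⊕ U₂)}

lemma adj_cases (hG : G ≤ completeBipartiteGraph U₁ U₂) {v w : U₁ ⊕ U₂} (h : G.Adj v w) :
    (∃ i j, v = Sum.inl i ∧ w = Sum.inr j) ∨ ∃ i j, v = Sum.inr j ∧ w = Sum.inl i := by
  have h1 := hG h
  rcases v with i | j <;> rcases w with i' | j' <;> simp_all

lemma not_adj_inl (hG : G ≤ completeBipartiteGraph U₁ U₂) (i i' : U₁) :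
    ¬ G.Adj (Sum.inl i) (Sum.inl i') := fun h => by simpa using hG h

lemma not_adj_inr (hG : G ≤ completeBipartiteGraph U₁ U₂) (j j' : U₂) :
    ¬ G.Adj (Sum.inr j) (Sum.inr j') := fun h => by simpa using hG h

/-- There are no edges inside `U₁`, so a second vertex would be unreachable. This is the source of
the vertices `a` in the classification, and the `inr` version that of the `b`. -/
lemma IsConnSet.exists_eq_singleton_inl (hG : G ≤ completeBipartiteGraph U₁ U₂)
    {S : Set (U₁ ⊕ U₂)} (h : IsConnSet G S) (hS : ∀ j, Sum.inr j ∉ S) : ∃ a, S = {Sum.inl a} := by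
  obtain ⟨v, hv⟩ := h.1
  rcases v with a | j
  · refine ⟨a, eq_singleton_iff_unique_mem.2 ⟨hv, fun w hw => ?_⟩⟩
    by_contra hwa
    obtain ⟨u, hu, hau⟩ := h.exists_adj_of_mem hv hw (Ne.symm hwa)
    rcases u with i | j
    · exact not_adj_inl hG _ _ hau
    · exact hS j hu
  · exact absurd hv (hS j)

lemma IsConnSet.exists_eq_singleton_inr (hG : G ≤ completeBipartiteGraph U₁ U₂)
    {S : Set (U₁ ⊕ U₂)} (h : IsConnSet G S) (hS : ∀ i, Sum.inl i ∉ S) : ∃ b, S = {Sum.inr b} := by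
  obtain ⟨v, hv⟩ := h.1
  rcases v with i | b
  · exact absurd hv (hS i)
  · refine ⟨b, eq_singleton_iff_unique_mem.2 ⟨hv, fun w hw => ?_⟩⟩
    by_contra hwa
    obtain ⟨u, hu, hau⟩ := h.exists_adj_of_mem hv hw (Ne.symm hwa)
    rcases u with i | j
    · exact hS i hu
    · exact not_adj_inr hG _ _ hau

/-- Neighbours avoid `F` because `F` is an up-set. Conversely, a vertex of `U₂` outside `F` is not
alone in the connected set `Fᶜ`, thanks to `hne`, so it has a neighbour there, necessarily in `U₁`.
-/
lemma IsSplit.nbr_side₁ (hG : G ≤ completeBipartiteGraph U₁ U₂) {F : Set (U₁ ⊕ U₂)}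
    (h : IsSplit G F) (hne : (side₁ U₁ U₂ \ F).Nonempty) :
    nbr G (side₁ U₁ U₂ \ F) = side₂ U₁ U₂ \ F := by
  obtain ⟨_, ⟨a, rfl⟩, ha⟩ := hne
  ext (i | j)
  · simpa [nbr] using fun i' _ => not_adj_inl hG i' i
  · simp only [nbr, mem_ofPred_eq, Sum.exists, mem_sdiff, inl_mem_side₁, inr_notMem_side₁,
      inr_mem_side₂, true_and, false_and, exists_false, or_false]
    constructor
    · rintro ⟨i, hi, hij⟩ hj
      exact hi (h.up i j hij hj)
    · intro hj
      obtain ⟨u, hu, hju⟩ := h.conn_compl.exists_adj_of_mem (v := Sum.inr j) hj ha (by simp)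
      rcases u with i | j'
      · exact ⟨i, hu, hju.symm⟩
      · exact absurd hju (not_adj_inr hG _ _)

lemma IsSplit.nbr_side₂ (hG : G ≤ completeBipartiteGraph U₁ U₂) {F : Set (U₁ ⊕ U₂)}
    (h : IsSplit G F) (hne : (side₂ U₁ U₂ ∩ F).Nonempty) :
    nbr G (side₂ U₁ U₂ ∩ F) = side₁ U₁ U₂ ∩ F := by
  obtain ⟨_, ⟨b, rfl⟩, hb⟩ := hne
  ext (i | j)
  · simp only [nbr, mem_ofPred_eq, Sum.exists, mem_inter_iff, inl_mem_side₁, inl_notMem_side₂,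
      inr_mem_side₂, true_and, false_and, exists_false, false_or]
    constructor
    · rintro ⟨j, hj, hij⟩
      exact h.up i j hij.symm hj
    · intro hi
      obtain ⟨u, hu, hju⟩ := h.conn.exists_adj_of_mem hi hb (by simp)
      rcases u with i | j'
      · exact absurd hju (not_adj_inl hG _ _)
      · exact ⟨j', hu, hju.symm⟩
  · simpa [nbr] using fun j' _ => not_adj_inr hG j' j

lemma twoBlock_adj {X Y : Set (U₁ ⊕ U₂)} {v w : U₁ ⊕ U₂} : (twoBlock G X Y).Adj v w ↔
    (v ∈ X ∧ w ∈ X ∧ G.Adj v w) ∨ (v ∈ Y ∧ w ∈ Y ∧ G.Adj v w) := by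
  simp only [twoBlock, SimpleGraph.sup_adj, SimpleGraph.spanningCoe, SimpleGraph.map_adj,
    SimpleGraph.comap_adj, Function.Embedding.subtype_apply, Subtype.exists]
  constructor
  · rintro (⟨_, h1, _, h2, h3, rfl, rfl⟩ | ⟨_, h1, _, h2, h3, rfl, rfl⟩)
    · exact Or.inl ⟨h1, h2, h3⟩
    · exact Or.inr ⟨h1, h2, h3⟩
  · rintro (⟨h1, h2, h3⟩ | ⟨h1, h2, h3⟩)
    · exact Or.inl ⟨_, h1, _, h2, h3, rfl, rfl⟩
    · exact Or.inr ⟨_, h1, _, h2, h3, rfl, rfl⟩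

lemma twoBlock_comm (X Y : Set (U₁ ⊕ U₂)) : twoBlock G X Y = twoBlock G Y X := sup_comm _ _

lemma twoBlock_compl_adj_mem {F : Set (U₁ ⊕ U₂)} {v w : U₁ ⊕ U₂}
    (h : (twoBlock G F Fᶜ).Adj v w) : v ∈ F ↔ w ∈ F := by
  rw [twoBlock_adj] at h
  simp only [mem_compl_iff] at h
  tauto

lemma card_twoBlock_compl {F : Set (U₁ ⊕ U₂)} (h : IsConnSet G F) (h' : IsConnSet G Fᶜ) :
    Nat.card (twoBlock G F Fᶜ).ConnectedComponent = 2 := by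
  obtain ⟨p, hp⟩ := h.1
  obtain ⟨q, hq⟩ := h'.1
  have h1 : IsConnSet (twoBlock G F Fᶜ) F := ⟨h.1, fun A hA hne hcl => h.2 A hA hne
    fun v hv w hw hvw => hcl v hv w hw (twoBlock_adj.2 (Or.inl ⟨hA hv, hw, hvw⟩))⟩
  have h2 : IsConnSet (twoBlock G F Fᶜ) Fᶜ := ⟨h'.1, fun A hA hne hcl => h'.2 A hA hne
    fun v hv w hw hvw => hcl v hv w hw (twoBlock_adj.2 (Or.inr ⟨hA hv, hw, hvw⟩))⟩
  rw [Nat.card_eq_two_iff]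
  refine ⟨(twoBlock G F Fᶜ).connectedComponentMk p, (twoBlock G F Fᶜ).connectedComponentMk q,
    fun hpq => ?_, eq_univ_of_forall fun c => ?_⟩
  · have h3 : (p ∈ F) = (q ∈ F) := eq_of_reachable (x := fun v => v ∈ F)
      (fun v w hvw => propext (twoBlock_compl_adj_mem hvw))
      (SimpleGraph.ConnectedComponent.exact hpq)
    exact hq (h3 ▸ hp)
  · induction c using SimpleGraph.ConnectedComponent.ind with
    | h v =>
      by_cases hv : v ∈ F
      · exact Or.inl (SimpleGraph.ConnectedComponent.sound (h1.reachable hv hp))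
      · exact Or.inr (SimpleGraph.ConnectedComponent.sound (h2.reachable hv hq))

/-- If `F` broke into `K` and `L`, colouring `K`, `L` and `Fᶜ` differently would exhibit three
components. -/
lemma isConnSet_of_card_twoBlock [Finite U₁] [Finite U₂] {F : Set (U₁ ⊕ U₂)} (hF : F.Nonempty)
    (hF' : Fᶜ.Nonempty) (h : Nat.card (twoBlock G F Fᶜ).ConnectedComponent = 2) :
    IsConnSet G F := by
  classical
  by_contra hc
  obtain ⟨K, L, ⟨k, hk⟩, ⟨l, hl⟩, hdisj, rfl, hKL⟩ := exists_split_of_not_isConnSet hF hc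
  obtain ⟨q, hq⟩ := hF'
  rw [Set.disjoint_right] at hdisj
  let c : U₁ ⊕ U₂ → Fin 3 := fun v => if v ∈ K then 0 else if v ∈ L then 1 else 2
  have hsurj : Function.Surjective c := by
    intro y
    fin_cases y
    · exact ⟨k, by simp [c, hk]⟩
    · exact ⟨l, by simp [c, hl, hdisj hl]⟩
    · exact ⟨q, by simp_all [c]⟩
  have h3 : 3 ≤ Nat.card (twoBlock G (K ∪ L) (K ∪ L)ᶜ).ConnectedComponent := by
    refine card_le_card_connectedComponent hsurj fun v w hvw => ?_
    rw [twoBlock_adj] at hvw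
    rcases hvw with ⟨hv, hw, hvw⟩ | ⟨hv, hw, -⟩
    · rcases hv with hv | hv <;> rcases hw with hw | hw
      · simp [c, hv, hw]
      · exact absurd hvw (hKL v hv w hw)
      · exact absurd hvw.symm (hKL w hw v hv)
      · simp [c, hv, hw, hdisj hv, hdisj hw]
    · simp only [mem_compl_iff, mem_union, not_or] at hv hw
      simp [c, hv, hw]
  omega

lemma isIndepSet_toggle (hG : G ≤ completeBipartiteGraph U₁ U₂) {F : Set (U₁ ⊕ U₂)}
    (h : IsSplit G F) : G.IsIndepSet (toggle F) := by
  intro v hv w hw _ hvw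
  rcases adj_cases hG hvw with ⟨i, j, rfl, rfl⟩ | ⟨i, j, rfl, rfl⟩
  · exact inl_mem_toggle.1 hv (h.up i j hvw (inr_mem_toggle.1 hw))
  · exact inl_mem_toggle.1 hw (h.up i j hvw.symm (inr_mem_toggle.1 hv))

/-- All three branches of `assocGraph` give the same graph, because `nbr_side₁` and `nbr_side₂`
complete each part of `toggle F` to one of the blocks `F`, `Fᶜ`. -/
lemma assocGraph_toggle (hG : G ≤ completeBipartiteGraph U₁ U₂) {F : Set (U₁ ⊕ U₂)}
    (h : IsSplit G F) (hne : (toggle F).Nonempty) :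
    assocGraph G (toggle F) = twoBlock G F Fᶜ := by
  rw [assocGraph]
  split_ifs with h1 h2
  · have h3 : ∀ j, Sum.inr j ∉ F := fun j hj => by
      simpa using h1 (inr_mem_toggle.2 hj)
    have h4 : toggle F = side₁ U₁ U₂ \ F := by
      ext (i | j) <;> simp [h3]
    rw [h4] at hne
    rw [h4, h.nbr_side₁ hG hne, twoBlock_comm]
    congr 1 <;> ext (i | j) <;> simp
  · have h3 : ∀ i, Sum.inl i ∈ F := fun i => by
      by_contra hi
      simpa using h2 (inl_mem_toggle.2 hi)
    have h4 : toggle F = side₂ U₁ U₂ ∩ F := by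
      ext (i | j) <;> simp [h3]
    rw [h4] at hne
    rw [h4, h.nbr_side₂ hG hne]
    congr 1 <;> ext (i | j) <;> simp
  · have h3 : (side₁ U₁ U₂ \ F).Nonempty := by
      obtain ⟨v, hv, hv'⟩ := not_subset.1 h2
      rcases v with i | j
      · exact ⟨Sum.inl i, by simp, inl_mem_toggle.1 hv⟩
      · simp at hv'
    have h4 : (side₂ U₁ U₂ ∩ F).Nonempty := by
      obtain ⟨v, hv, hv'⟩ := not_subset.1 h1
      rcases v with i | j
      · simp at hv'
      · exact ⟨Sum.inr j, by simp, inr_mem_toggle.1 hv⟩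
    rw [part₁_toggle, part₂_toggle, h.nbr_side₁ hG h3, h.nbr_side₂ hG h4, twoBlock_comm]
    congr 1 <;> ext (i | j) <;> simp

lemma exists_adj_inl (hG : G ≤ completeBipartiteGraph U₁ U₂) (hconn : G.Connected) (i : U₁)
    (j : U₂) : ∃ j', G.Adj (Sum.inl i) (Sum.inr j') := by
  obtain ⟨u, -, hu⟩ := (isConnSet_univ hconn).exists_adj_of_mem (mem_univ (Sum.inl i))
    (mem_univ (Sum.inr j)) (by simp)
  rcases u with i' | j'
  · exact absurd hu (not_adj_inl hG _ _)
  · exact ⟨j', hu⟩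

lemma exists_adj_inr (hG : G ≤ completeBipartiteGraph U₁ U₂) (hconn : G.Connected) (i : U₁)
    (j : U₂) : ∃ i', G.Adj (Sum.inl i') (Sum.inr j) := by
  obtain ⟨u, -, hu⟩ := (isConnSet_univ hconn).exists_adj_of_mem (mem_univ (Sum.inr j))
    (mem_univ (Sum.inl i)) (by simp)
  rcases u with i' | j'
  · exact ⟨i', hu.symm⟩
  · exact absurd hu (not_adj_inr hG _ _)

/-- Properness of each part comes from connectedness of `G`: a vertex `b` of `U₂` in `F` has a
neighbour, which lies in `F` and so outside `toggle F`; similarly for a vertex of `U₁` outside `F`.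
-/
lemma IsSplit.isTwoSided (hG : G ≤ completeBipartiteGraph U₁ U₂) (hconn : G.Connected)
    {F : Set (U₁ ⊕ U₂)} (h : IsSplit G F) (h₁ : (side₁ U₁ U₂ \ F).Nonempty)
    (h₂ : (side₂ U₁ U₂ ∩ F).Nonempty) : IsTwoSided G (toggle F) := by
  refine ⟨⟨h₁.mono subset_union_left, isIndepSet_toggle hG h⟩, ?_, ?_, ?_, ?_⟩
  · rwa [part₁_toggle]
  · obtain ⟨_, ⟨a, rfl⟩, ha⟩ := h₁
    obtain ⟨_, ⟨b, rfl⟩, hb⟩ := h₂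
    obtain ⟨i, hi⟩ := exists_adj_inr hG hconn a b
    rw [part₁_toggle]
    refine sdiff_subset.ssubset_of_ne fun he => ?_
    have h3 := he.symm ▸ inl_mem_side₁ i
    exact h3.2 (h.up i b hi hb)
  · rwa [part₂_toggle]
  · obtain ⟨_, ⟨a, rfl⟩, ha⟩ := h₁
    obtain ⟨_, ⟨b, rfl⟩, hb⟩ := h₂
    obtain ⟨j, hj⟩ := exists_adj_inl hG hconn a b
    rw [part₂_toggle]
    refine inter_subset_left.ssubset_of_ne fun he => ?_
    have h3 := he.symm ▸ inr_mem_side₂ j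
    exact ha (h.up a j hj h3.2)

lemma IsSplit.maximal (hG : G ≤ completeBipartiteGraph U₁ U₂)
    {F : Set (U₁ ⊕ U₂)} (h : IsSplit G F) (h₁ : (side₁ U₁ U₂ \ F).Nonempty)
    (h₂ : (side₂ U₁ U₂ ∩ F).Nonempty) : Maximal (IsIndep G) (toggle F) := by
  refine ⟨⟨h₁.mono subset_union_left, isIndepSet_toggle hG h⟩, fun B hB hAB v hv => ?_⟩
  by_contra hvF
  rcases v with i | j
  · rw [inl_mem_toggle, not_not] at hvF
    have h3 : Sum.inl i ∈ nbr G (side₂ U₁ U₂ ∩ F) := by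
      rw [h.nbr_side₂ hG h₂]
      exact ⟨inl_mem_side₁ i, hvF⟩
    obtain ⟨a, ha, hai⟩ := h3
    exact hB.2 (hAB (Or.inr ha)) hv hai.ne hai
  · rw [inr_mem_toggle] at hvF
    have h3 : Sum.inr j ∈ nbr G (side₁ U₁ U₂ \ F) := by
      rw [h.nbr_side₁ hG h₁]
      exact ⟨inr_mem_side₂ j, hvF⟩
    obtain ⟨a, ha, hai⟩ := h3
    exact hB.2 (hAB (Or.inl ha)) hv hai.ne hai

/-- If `toggle F` misses one class, then `F` or `Fᶜ` lies in a single class and is one vertex. Every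
vertex of the missed class is then adjacent to `toggle F`, so no two-sided independent set contains
it. -/
lemma IsSplit.isFirst (hG : G ≤ completeBipartiteGraph U₁ U₂) (hconn : G.Connected)
    {F : Set (U₁ ⊕ U₂)} (h : IsSplit G F) (hne : (toggle F).Nonempty) :
    IsFirst G (toggle F) := by
  refine ⟨?_, by rw [assocGraph_toggle hG h hne, card_twoBlock_compl h.conn h.conn_compl]⟩
  by_cases h₁ : (side₁ U₁ U₂ \ F).Nonempty
  · by_cases h₂ : (side₂ U₁ U₂ ∩ F).Nonempty
    · exact Or.inl ⟨h.isTwoSided hG hconn h₁ h₂, h.maximal hG h₁ h₂⟩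
    · right
      have h3 : ∀ j, Sum.inr j ∉ F := fun j hj => h₂ ⟨_, inr_mem_side₂ j, hj⟩
      obtain ⟨a, ha⟩ := h.conn.exists_eq_singleton_inl hG h3
      refine ⟨⟨hne, isIndepSet_toggle hG h⟩, Or.inl ⟨a, by rw [ha, toggle_singleton_inl]⟩, ?_⟩
      intro A' hA' hsub
      obtain ⟨_, hj, ⟨j, rfl⟩⟩ := hA'.2.2.2.1
      have h4 : Sum.inr j ∈ nbr G (side₁ U₁ U₂ \ F) := by
        rw [h.nbr_side₁ hG h₁]
        exact ⟨inr_mem_side₂ j, h3 j⟩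
      obtain ⟨v, hv, hvj⟩ := h4
      exact hA'.1.2 (hsub (Or.inl hv)) hj hvj.ne hvj
  · right
    have h3 : ∀ i, Sum.inl i ∉ Fᶜ := fun i hi => h₁ ⟨_, inl_mem_side₁ i, hi⟩
    have h₂ : (side₂ U₁ U₂ ∩ F).Nonempty := by
      rw [toggle, not_nonempty_iff_eq_empty.1 h₁, empty_union] at hne
      exact hne
    obtain ⟨b, hb⟩ := h.conn_compl.exists_eq_singleton_inr hG h3
    refine ⟨⟨hne, isIndepSet_toggle hG h⟩, Or.inr ⟨b, ?_⟩, ?_⟩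
    · rw [← toggle_compl_singleton_inr, ← hb, compl_compl]
    · intro A' hA' hsub
      obtain ⟨_, hi, ⟨i, rfl⟩⟩ := hA'.2.1
      have h4 : Sum.inl i ∈ nbr G (side₂ U₁ U₂ ∩ F) := by
        rw [h.nbr_side₂ hG h₂]
        exact ⟨inl_mem_side₁ i, by simpa using h3 i⟩
      obtain ⟨v, hv, hvj⟩ := h4
      exact hA'.1.2 (hsub (Or.inr hv)) hi hvj.ne hvj

/-- A vertex of `U₂` outside `C` with no neighbour in `C` could be adjoined to `C`. -/
lemma nbr_part₁_of_maximal (hG : G ≤ completeBipartiteGraph U₁ U₂) {C : Set (U₁ ⊕ U₂)}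
    (h : Maximal (IsIndep G) C) : nbr G (part₁ C) = side₂ U₁ U₂ \ C := by
  ext (i | j)
  · simpa [nbr, part₁] using fun i' _ => not_adj_inl hG i' i
  · constructor
    · rintro ⟨v, hv, hvj⟩
      exact ⟨inr_mem_side₂ j, fun hj => h.1.2 hv.1 hj hvj.ne hvj⟩
    · rintro ⟨-, hj⟩
      by_contra hc
      refine hj (h.2 (y := insert (Sum.inr j) C) ⟨insert_nonempty _ _, ?_⟩ (subset_insert _ _)
        (mem_insert _ _))
      suffices key : ∀ v ∈ C, ¬ G.Adj (Sum.inr j) v from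
        h.1.2.insert fun v hv _ => ⟨key v hv, fun hvj => key v hv hvj.symm⟩
      rintro (i' | j') hv hjv
      · exact hc ⟨_, ⟨hv, inl_mem_side₁ i'⟩, hjv.symm⟩
      · exact not_adj_inr hG _ _ hjv

lemma nbr_part₂_of_maximal (hG : G ≤ completeBipartiteGraph U₁ U₂) {C : Set (U₁ ⊕ U₂)}
    (h : Maximal (IsIndep G) C) : nbr G (part₂ C) = side₁ U₁ U₂ \ C := by
  ext (i | j)
  · constructor
    · rintro ⟨v, hv, hvi⟩
      exact ⟨inl_mem_side₁ i, fun hi => h.1.2 hv.1 hi hvi.ne hvi⟩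
    · rintro ⟨-, hi⟩
      by_contra hc
      refine hi (h.2 (y := insert (Sum.inl i) C) ⟨insert_nonempty _ _, ?_⟩ (subset_insert _ _)
        (mem_insert _ _))
      suffices key : ∀ v ∈ C, ¬ G.Adj (Sum.inl i) v from
        h.1.2.insert fun v hv _ => ⟨key v hv, fun hvi => key v hv hvi.symm⟩
      rintro (i' | j') hv hiv
      · exact not_adj_inl hG _ _ hiv
      · exact hc ⟨_, ⟨hv, inr_mem_side₂ j'⟩, hiv.symm⟩
  · simpa [nbr, part₂] using fun j' _ => not_adj_inr hG j' j

/-- A two-sided set contains itself, so it cannot be of the one-sided kind and must be maximal. Its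
associated graph is then the two-block graph of `toggle C` and its complement, and having two
components makes both blocks connected. -/
lemma IsFirst.isSplit [Finite U₁] [Finite U₂] (hG : G ≤ completeBipartiteGraph U₁ U₂)
    {C : Set (U₁ ⊕ U₂)} (hC : IsFirst G C) (h2 : IsTwoSided G C) : IsSplit G (toggle C) := by
  have hmax : Maximal (IsIndep G) C := by
    rcases hC.1 with h | h
    · exact h.2
    · exact absurd Subset.rfl (h.2.2 C h2)
  obtain ⟨_, hi, ⟨i, rfl⟩⟩ := h2.2.1
  obtain ⟨_, hj, ⟨j, rfl⟩⟩ := h2.2.2.2.1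
  have hcard := hC.2
  have h3 : assocGraph G C = twoBlock G (toggle C) (toggle C)ᶜ := by
    rw [assocGraph, if_neg fun h => by simpa using h hj, if_neg fun h => by simpa using h hi,
      nbr_part₁_of_maximal hG hmax, nbr_part₂_of_maximal hG hmax, twoBlock_comm]
    congr 1 <;> ext (i | j) <;> simp [part₁, part₂]
  rw [h3] at hcard
  have hne : (toggle C).Nonempty := ⟨_, inr_mem_toggle.2 hj⟩
  have hne' : (toggle C)ᶜ.Nonempty := ⟨Sum.inl i, by simpa using hi⟩
  refine ⟨?_, isConnSet_of_card_twoBlock hne hne' hcard, ?_⟩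
  · intro i' j' hadj hj'
    rw [inl_mem_toggle]
    rw [inr_mem_toggle] at hj'
    exact fun hi' => hmax.1.2 hi' hj' hadj.ne hadj
  · refine isConnSet_of_card_twoBlock hne' (by rwa [compl_compl]) ?_
    rwa [compl_compl, twoBlock_comm]

lemma IsSplit.exists_adj (hconn : G.Connected) {F : Set (U₁ ⊕ U₂)} (h : IsSplit G F) :
    ∃ v ∉ F, ∃ w ∈ F, G.Adj v w := by
  obtain ⟨v, hv, w, hw, hvw⟩ := (isConnSet_univ hconn).exists_adj (subset_univ F) h.conn.1
    (by simpa [compl_eq_univ_sdiff] using h.conn_compl.1)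
  exact ⟨w, hw.2, v, hv, hvw.symm⟩

end Splits

/-! ### The extremal ray of an up-set. -/

section SplitRays

variable {U₁ U₂ : Type*} [Fintype U₁] [Fintype U₂] {G : SimpleGraph (U₁ ⊕ U₂)}

lemma pairing_edgeVec_vec_eq_zero_iff {F : Set (U₁ ⊕ U₂)} {i : U₁} {j : U₂} :
    pairing U₁ U₂ (edgeVec i j) (vec F) = 0 ↔ (Sum.inl i ∈ F ↔ Sum.inr j ∈ F) := by
  classical
  rw [vec, pairing_edgeVec_ofPot, Set.indicator_apply, Set.indicator_apply]
  split_ifs <;> simp_all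

lemma vec_mem_edgeCone {F : Set (U₁ ⊕ U₂)}
    (h : ∀ i j, G.Adj (Sum.inl i) (Sum.inr j) → Sum.inr j ∈ F → Sum.inl i ∈ F) :
    vec F ∈ edgeCone G := by
  classical
  rw [vec, ofPot_mem_edgeCone_iff]
  intro i j hij
  have := h i j hij
  rw [Set.indicator_apply, Set.indicator_apply]
  split_ifs <;> simp_all

lemma sum_oneNegOne_mul (m : MSpace U₁ U₂) : ∑ v, oneNegOne U₁ U₂ v * m.1 v = 0 := m.2

lemma pairing_vec (m : MSpace U₁ U₂) (F : Set (U₁ ⊕ U₂)) : pairing U₁ U₂ m (vec F) =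
    ∑ v, oneNegOne U₁ U₂ v * F.indicator (1 : U₁ ⊕ U₂ → ℚ) v * m.1 v := rfl

lemma mem_suppHyperplane_iff (hG : G ≤ completeBipartiteGraph U₁ U₂) {F : Set (U₁ ⊕ U₂)}
    (h : IsSplit G F) (hne : (toggle F).Nonempty) (m : MSpace U₁ U₂) :
    m ∈ suppHyperplane G (open Classical in if (part₁ (toggle F)).Nonempty then part₁ (toggle F)
      else part₂ (toggle F)) ↔ pairing U₁ U₂ m (vec F) = 0 := by
  classical
  rw [suppHyperplane, mem_ofPred_eq, ← sub_eq_zero, ← neg_eq_zero, neg_sub, pairing_vec]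
  have key : ∀ x y : ℚ, x = y → (x = 0 ↔ y = 0) := fun x y h => by rw [h]
  apply key
  rw [part₁_toggle, part₂_toggle]
  split_ifs with h1
  -- The hyperplane compares sums over the parts outside `F`, while `vec F` sees the parts inside;
  -- the relation defining `M_ℚ` exchanges them.
  · rw [h.nbr_side₁ hG h1, ← sub_zero (∑ v, _ * _), ← sum_oneNegOne_mul m,
      ← Finset.sum_sub_distrib, ← Finset.sum_sub_distrib]
    refine Finset.sum_congr rfl fun v _ => ?_
    rcases v with i | j
    · by_cases hv : Sum.inl i ∈ F <;> simp [hv, oneNegOne]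
    · by_cases hv : Sum.inr j ∈ F <;> simp [hv, oneNegOne]
  · have h2 : (side₂ U₁ U₂ ∩ F).Nonempty := by
      rw [toggle, not_nonempty_iff_eq_empty.1 h1, empty_union] at hne
      exact hne
    rw [h.nbr_side₂ hG h2, ← Finset.sum_sub_distrib]
    refine Finset.sum_congr rfl fun v _ => ?_
    rcases v with i | j
    · by_cases hv : Sum.inl i ∈ F <;> simp [hv, oneNegOne]
    · by_cases hv : Sum.inr j ∈ F <;> simp [hv, oneNegOne]

/-- Potentials in the cone increase along edges entering an up-set. -/
lemma IsSplit.le_of_adj (hG : G ≤ completeBipartiteGraph U₁ U₂) {F : Set (U₁ ⊕ U₂)}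
    (h : IsSplit G F) {x : U₁ ⊕ U₂ → ℚ} (hx : ofPot U₁ U₂ x ∈ edgeCone G) {v w : U₁ ⊕ U₂}
    (hvw : G.Adj v w) (hv : v ∉ F) (hw : w ∈ F) : x v ≤ x w := by
  rw [ofPot_mem_edgeCone_iff] at hx
  rcases adj_cases hG hvw with ⟨i, j, rfl, rfl⟩ | ⟨i, j, rfl, rfl⟩
  · exact absurd (h.up i j hvw hw) hv
  · exact hx i j hvw.symm

/-- A point of the ray is constant along edges that do not cross between `Fᶜ` and `F`, hence takes
one value on each of these connected sets. A crossing edge exists and shows that the value on `F` is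
at least the other. -/
lemma mem_ray_toggle_iff (hG : G ≤ completeBipartiteGraph U₁ U₂) (hconn : G.Connected)
    {F : Set (U₁ ⊕ U₂)} (h : IsSplit G F) (hne : (toggle F).Nonempty) {n : NSpace U₁ U₂} :
    n ∈ ray G (toggle F) ↔ ∃ c : ℚ, 0 ≤ c ∧ n = c • vec F := by
  classical
  rw [ray, mem_dualFace_iff]
  constructor
  · rintro ⟨hn, hm⟩
    obtain ⟨x, rfl⟩ := ofPot_surjective n
    have hx : ∀ v w, G.Adj v w → (v ∈ F ↔ w ∈ F) → x v = x w := by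
      have key : ∀ i j, G.Adj (Sum.inl i) (Sum.inr j) → (Sum.inl i ∈ F ↔ Sum.inr j ∈ F) →
          x (Sum.inl i) = x (Sum.inr j) := by
        intro i j hij hF
        have := hm (edgeVec i j) ⟨(mem_suppHyperplane_iff hG h hne _).2
          (pairing_edgeVec_vec_eq_zero_iff.2 hF), edgeVec_mem hij⟩
        rwa [pairing_edgeVec_ofPot, sub_eq_zero] at this
      intro v w hvw hF
      rcases adj_cases hG hvw with ⟨i, j, rfl, rfl⟩ | ⟨i, j, rfl, rfl⟩
      · exact key i j hvw hF
      · exact (key i j hvw.symm hF.symm).symm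
    obtain ⟨v, hv, w, hw, hvw⟩ := h.exists_adj hconn
    refine ⟨x w - x v, sub_nonneg.2 (h.le_of_adj hG hn hvw hv hw), ?_⟩
    rw [vec, ← map_smul, ofPot_eq_iff]
    refine ⟨x v, fun u => ?_⟩
    by_cases hu : u ∈ F
    · have := h.conn.eq_of_forall_adj (x := x) (fun a ha b hb hab => hx a b hab (by tauto)) hu hw
      simp [hu, this]
    · have := h.conn_compl.eq_of_forall_adj (x := x)
        (fun a ha b hb hab => hx a b hab (by rw [mem_compl_iff] at ha hb; tauto)) hu hv
      simp [hu, this]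
  · rintro ⟨c, hc, rfl⟩
    refine ⟨PointedCone.smul_mem _ hc (vec_mem_edgeCone h.up), fun m hm => ?_⟩
    rw [map_smul, (mem_suppHyperplane_iff hG h hne m).1 hm.1, smul_zero]

lemma ray_toggle_isFaceOf (F : Set (U₁ ⊕ U₂)) : (ray G (toggle F)).IsFaceOf (edgeCone G) :=
  dualFace_isFaceOf G inter_subset_right

lemma vec_mem_ray (hG : G ≤ completeBipartiteGraph U₁ U₂) (hconn : G.Connected)
    {F : Set (U₁ ⊕ U₂)} (h : IsSplit G F) (hne : (toggle F).Nonempty) :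
    vec F ∈ ray G (toggle F) :=
  (mem_ray_toggle_iff hG hconn h hne).2 ⟨1, zero_le_one, (one_smul _ _).symm⟩

lemma coneDim_ray_toggle (hG : G ≤ completeBipartiteGraph U₁ U₂) (hconn : G.Connected)
    {F : Set (U₁ ⊕ U₂)} (h : IsSplit G F) (hne : (toggle F).Nonempty) :
    coneDim (ray G (toggle F)) = 1 := by
  have h1 : Submodule.span ℚ (ray G (toggle F) : Set (NSpace U₁ U₂)) =
      Submodule.span ℚ {vec F} := by
    apply le_antisymm
    · rw [Submodule.span_le]
      intro n hn
      obtain ⟨c, -, rfl⟩ := (mem_ray_toggle_iff hG hconn h hne).1 hn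
      exact Submodule.smul_mem _ _ (Submodule.mem_span_singleton_self _)
    · rw [Submodule.span_singleton_le_iff_mem]
      exact Submodule.subset_span (vec_mem_ray hG hconn h hne)
  rw [coneDim, h1, finrank_span_singleton (vec_ne_zero h.conn.1 h.conn_compl.1)]

/-- Criterion for a tuple of up-sets to form a given face. -/
lemma formsFace_toggle (hG : G ≤ completeBipartiteGraph U₁ U₂) (hconn : G.Connected) {d t : ℕ}
    {F : Fin t → Set (U₁ ⊕ U₂)} (hinj : Function.Injective F) (h : ∀ k, IsSplit G (F k))
    (hne : ∀ k, (toggle (F k)).Nonempty) {τ : PointedCone ℚ (NSpace U₁ U₂)}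
    (hτ : τ.IsFaceOf (edgeCone G)) (hdim : coneDim τ = d) (hmem : ∀ k, vec (F k) ∈ τ)
    (hgen : ∀ x, ofPot U₁ U₂ x ∈ τ → ∃ (c : ℚ) (α : Fin t → ℚ), (∀ k, 0 ≤ α k) ∧
      ∀ v, x v = (∑ k, α k * (F k).indicator 1 v) + c) :
    FormsFace G d (fun k => toggle (F k)) τ := by
  have hle : ∀ k, ray G (toggle (F k)) ≤ τ := by
    intro k n hn
    obtain ⟨c, hc, rfl⟩ := (mem_ray_toggle_iff hG hconn (h k) (hne k)).1 hn
    exact PointedCone.smul_mem _ hc (hmem k)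
  refine ⟨fun a b hab => hinj (toggle_injective hab), fun k => (h k).isFirst hG hconn (hne k), hτ,
    hdim, fun k => ⟨((ray_toggle_isFaceOf (F k)).isFaceOf_iff_le hτ).2 (hle k),
      coneDim_ray_toggle hG hconn (h k) (hne k)⟩, le_antisymm ?_ (iSup_le hle)⟩
  intro n hn
  obtain ⟨x, rfl⟩ := ofPot_surjective n
  obtain ⟨c, α, hα, hx⟩ := hgen x hn
  have h1 : ofPot U₁ U₂ x = ∑ k, α k • vec (F k) := by
    simp only [vec, ← map_smul, ← map_sum]
    rw [ofPot_eq_iff]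
    exact ⟨c, fun v => by rw [hx v]; simp⟩
  rw [h1]
  refine Submodule.sum_mem _ fun k _ => ?_
  exact PointedCone.smul_mem _ (hα k)
    (le_iSup (fun k => ray G (toggle (F k))) k (vec_mem_ray hG hconn (h k) (hne k)))

lemma FormsFace.comp_equiv {d t : ℕ} {I : Fin t → Set (U₁ ⊕ U₂)}
    {τ : PointedCone ℚ (NSpace U₁ U₂)} (h : FormsFace G d I τ) (e : Equiv.Perm (Fin t)) :
    FormsFace G d (I ∘ e) τ := by
  obtain ⟨h1, h2, h3, h4, h5, h6⟩ := h
  refine ⟨h1.comp e.injective, fun k => h2 _, h3, h4, fun k => h5 _, ?_⟩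
  rw [h6]
  exact (e.iSup_comp (g := fun k => ray G (I k))).symm

end SplitRays

/-! ### Tight edges and the dimension of a face. -/

section Faces

variable {U₁ U₂ : Type*} {G : SimpleGraph (U₁ ⊕ U₂)}

/-- The edges of `G` along which all potentials in the cone `τ` are constant. -/
def tightGraph (G : SimpleGraph (U₁ ⊕ U₂)) (τ : PointedCone ℚ (NSpace U₁ U₂)) :
    SimpleGraph (U₁ ⊕ U₂) where
  Adj v w := G.Adj v w ∧ ∀ x, ofPot U₁ U₂ x ∈ τ → x v = x w
  symm := ⟨fun _ _ h => ⟨h.1.symm, fun x hx => (h.2 x hx).symm⟩⟩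
  loopless := ⟨fun _ h => G.irrefl h.1⟩

lemma tightGraph_le (τ : PointedCone ℚ (NSpace U₁ U₂)) : tightGraph G τ ≤ G := fun _ _ h => h.1

variable [Fintype U₁] [Fintype U₂] {τ : PointedCone ℚ (NSpace U₁ U₂)}

/-- For each edge not tight, choose a point of `τ` pairing positively with it, and add all choices.
Pairings are nonnegative, so nothing cancels. -/
lemma exists_interior_point (hτ : τ.IsFaceOf (edgeCone G)) : ∃ n₀ ∈ τ, ∀ i j,
    G.Adj (Sum.inl i) (Sum.inr j) → pairing U₁ U₂ (edgeVec i j) n₀ = 0 →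
      (tightGraph G τ).Adj (Sum.inl i) (Sum.inr j) := by
  have h : ∀ p : U₁ × U₂, ∃ n ∈ τ, pairing U₁ U₂ (edgeVec p.1 p.2) n = 0 →
      ∀ n' ∈ τ, pairing U₁ U₂ (edgeVec p.1 p.2) n' = 0 := by
    intro p
    by_cases hp : ∀ n' ∈ τ, pairing U₁ U₂ (edgeVec p.1 p.2) n' = 0
    · exact ⟨0, τ.zero_mem, fun _ => hp⟩
    · push Not at hp
      obtain ⟨n, hn, hne⟩ := hp
      exact ⟨n, hn, fun h0 => absurd h0 hne⟩
  choose n hn hz using h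
  refine ⟨∑ p, n p, Submodule.sum_mem _ fun p _ => hn p, fun i j hij h0 => ⟨hij, fun x hx => ?_⟩⟩
  rw [map_sum, Finset.sum_eq_zero_iff_of_nonneg
    fun p _ => pairing_nonneg (hτ.le (hn p)) (edgeVec_mem hij)] at h0
  have := hz (i, j) (h0 (i, j) (Finset.mem_univ _)) _ hx
  rwa [pairing_edgeVec_ofPot, sub_eq_zero] at this

/-- A face is determined by its tight edges: a large multiple of the interior point is the sum of
`x` and another element of the cone, so the face property applies to `x`. -/
lemma ofPot_mem_of_tight (hτ : τ.IsFaceOf (edgeCone G)) {x : U₁ ⊕ U₂ → ℚ}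
    (hx : ofPot U₁ U₂ x ∈ edgeCone G) (ht : ∀ v w, (tightGraph G τ).Adj v w → x v = x w) :
    ofPot U₁ U₂ x ∈ τ := by
  obtain ⟨n₀, hn₀, hz⟩ := exists_interior_point hτ
  obtain ⟨K, hK, hK'⟩ := exists_smul_sub_mem G (n := ofPot U₁ U₂ x) (hτ.le hn₀) fun i j hij h0 => by
    rw [pairing_edgeVec_ofPot, sub_eq_zero]
    exact ht _ _ (hz i j hij h0)
  refine hτ.mem_of_add_mem_left hx hK' ?_
  rw [add_sub_cancel]
  exact PointedCone.smul_mem _ hK hn₀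

lemma ofPot_mem_span_of_tight (hτ : τ.IsFaceOf (edgeCone G)) {x : U₁ ⊕ U₂ → ℚ}
    (ht : ∀ v w, (tightGraph G τ).Adj v w → x v = x w) :
    ofPot U₁ U₂ x ∈ Submodule.span ℚ (τ : Set (NSpace U₁ U₂)) := by
  obtain ⟨n₀, hn₀, hz⟩ := exists_interior_point hτ
  obtain ⟨y, rfl⟩ := ofPot_surjective n₀
  obtain ⟨K, hK, hK'⟩ := exists_smul_sub_mem G (n := ofPot U₁ U₂ x) (hτ.le hn₀) fun i j hij h0 => by
    rw [pairing_edgeVec_ofPot, sub_eq_zero]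
    exact ht _ _ (hz i j hij h0)
  rw [← map_smul, ← map_sub] at hK'
  have h1 := ofPot_mem_of_tight hτ hK' fun v w hvw => by
    simp [ht v w hvw, hvw.2 y hn₀]
  have h2 := Submodule.sub_mem _ (Submodule.smul_mem _ K (Submodule.subset_span hn₀))
    (Submodule.subset_span (R := ℚ) h1)
  rwa [map_sub, map_smul, sub_sub_cancel] at h2

/-- Functions of the colour give a `k`-dimensional space of potentials in the span of `τ`; passing
to `N_ℚ` loses only the constants, which accounts for the `+ 1`. -/
lemma le_coneDim_add_one (hτ : τ.IsFaceOf (edgeCone G)) {k : ℕ} {c : U₁ ⊕ U₂ → Fin k}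
    (hc : Function.Surjective c) (hadj : ∀ v w, (tightGraph G τ).Adj v w → c v = c w) :
    k ≤ coneDim τ + 1 := by
  let f : (Fin k → ℚ) →ₗ[ℚ] NSpace U₁ U₂ := ofPot U₁ U₂ ∘ₗ LinearMap.funLeft ℚ ℚ c
  have h1 : LinearMap.range f ≤ Submodule.span ℚ (τ : Set (NSpace U₁ U₂)) := by
    rintro _ ⟨t, rfl⟩
    exact ofPot_mem_span_of_tight hτ fun v w hvw => by
      simp [LinearMap.funLeft_apply, hadj v w hvw]
  have h2 : LinearMap.ker f ≤ Submodule.span ℚ {(1 : Fin k → ℚ)} := by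
    intro t ht
    obtain ⟨d, hd⟩ := ofPot_eq_zero_iff.1 (LinearMap.mem_ker.1 ht)
    refine Submodule.mem_span_singleton.2 ⟨d, ?_⟩
    ext y
    obtain ⟨v, rfl⟩ := hc y
    simpa [LinearMap.funLeft_apply] using (hd v).symm
  have h3 := LinearMap.finrank_range_add_finrank_ker f
  have h4 := Submodule.finrank_mono h1
  have h5 := (Submodule.finrank_mono h2).trans (finrank_span_le_card {(1 : Fin k → ℚ)})
  rw [Module.finrank_fintype_fun_eq_card, Fintype.card_fin] at h3
  simp only [toFinset_singleton, Finset.card_singleton] at h5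
  rw [coneDim]
  omega

end Faces

/-! ### When two rays do, or do not, form a two-dimensional face. -/

section FacePairs

variable {U₁ U₂ : Type*} [Fintype U₁] [Fintype U₂] {G : SimpleGraph (U₁ ⊕ U₂)}

/-- Two extremal rays whose sum is also the sum of two other ones do not span a face. -/
lemma not_memFaceTuples_of_add_eq (hG : G ≤ completeBipartiteGraph U₁ U₂) (hconn : G.Connected)
    {F F' P P' : Set (U₁ ⊕ U₂)} (hF : IsSplit G F) (hF' : IsSplit G F') (hP : IsSplit G P)
    (hP' : IsSplit G P') (hFne : (toggle F).Nonempty)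
    (hPne : (toggle P).Nonempty) (hPne' : (toggle P').Nonempty)
    (hadd : vec P + vec P' = vec F + vec F') (h1 : P ≠ F) (h2 : P' ≠ F) :
    ¬ MemFaceTuples G 2 ![toggle P, toggle P'] := by
  rintro ⟨τ, -, -, hτ, -, -, hsup⟩
  have hle : τ ≤ ray G (toggle P) ⊔ ray G (toggle P') := by
    rw [hsup]
    exact iSup_le (Fin.forall_fin_two.2 ⟨le_sup_left, le_sup_right⟩)
  have hle' : ray G (toggle P) ⊔ ray G (toggle P') ≤ τ := by
    rw [hsup]
    exact sup_le (le_iSup (fun k : Fin 2 => ray G (![toggle P, toggle P'] k)) 0)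
      (le_iSup (fun k : Fin 2 => ray G (![toggle P, toggle P'] k)) 1)
  have hsum : vec F + vec F' ∈ τ := hadd ▸ τ.add_mem
    (hle' (Submodule.mem_sup_left (vec_mem_ray hG hconn hP hPne)))
    (hle' (Submodule.mem_sup_right (vec_mem_ray hG hconn hP' hPne')))
  have hFτ := hτ.mem_of_add_mem_left (vec_mem_edgeCone hF.up) (vec_mem_edgeCone hF'.up) hsum
  obtain ⟨y, hy, z, hz, hyz⟩ := Submodule.mem_sup.1 (hle hFτ)
  have hFray := ray_toggle_isFaceOf (G := G) F
  have hyz' : y + z ∈ ray G (toggle F) := hyz ▸ vec_mem_ray hG hconn hF hFne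
  have hyσ := (ray_toggle_isFaceOf P).le hy
  have hzσ := (ray_toggle_isFaceOf P').le hz
  -- `vec F` splits as a sum of points of the rays of `P` and `P'`. The ray of `F` is a face, so it
  -- contains both summands; distinct rays meet only in `0`, which would make `vec F` vanish.
  have key : ∀ Q : Set (U₁ ⊕ U₂), IsSplit G Q → (toggle Q).Nonempty → Q ≠ F →
      ∀ u ∈ ray G (toggle Q), u ∈ ray G (toggle F) → u = 0 := by
    intro Q hQ hQne hQF u hu hu'
    obtain ⟨a, ha, rfl⟩ := (mem_ray_toggle_iff hG hconn hQ hQne).1 hu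
    obtain ⟨b, hb, hab⟩ := (mem_ray_toggle_iff hG hconn hF hFne).1 hu'
    by_cases h0 : a = 0
    · rw [h0, zero_smul]
    · refine absurd (eq_of_vec_eq_smul hQ.conn.1 hQ.conn_compl.1 (div_nonneg hb ha) ?_) hQF
      rw [div_eq_inv_mul, mul_smul, ← hab, inv_smul_smul₀ h0]
  rw [key P hP hPne h1 y hy (hFray.mem_of_add_mem_left hyσ hzσ hyz'),
    key P' hP' hPne' h2 z hz (hFray.mem_of_add_mem_right hyσ hzσ hyz'), add_zero] at hyz
  exact vec_ne_zero hF.conn.1 hF.conn_compl.1 hyz.symm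

/-- The candidate face is cut out by the edges along which both indicators are constant. The points
`p`, `p'`, `k` give independence modulo constants: at `k` the indicators agree, which eliminates the
constant. -/
lemma memFaceTuples_pair (hG : G ≤ completeBipartiteGraph U₁ U₂) (hconn : G.Connected)
    {F F' : Set (U₁ ⊕ U₂)} (hF : IsSplit G F) (hF' : IsSplit G F')
    (hne : (toggle F).Nonempty) (hne' : (toggle F').Nonempty)
    {p p' k : U₁ ⊕ U₂} (hp : p ∈ F \ F') (hp' : p' ∈ F' \ F) (hk : k ∈ F ↔ k ∈ F')
    (hgen : ∀ x, ofPot U₁ U₂ x ∈ edgeCone G →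
      (∀ v w, G.Adj v w → (v ∈ F ↔ w ∈ F) → (v ∈ F' ↔ w ∈ F') → x v = x w) →
      ∃ c α β : ℚ, 0 ≤ α ∧ 0 ≤ β ∧ ∀ v, x v = α * F.indicator 1 v + β * F'.indicator 1 v + c) :
    MemFaceTuples G 2 ![toggle F, toggle F'] := by
  classical
  let S : Set (MSpace U₁ U₂) := {m | ∃ i j, G.Adj (Sum.inl i) (Sum.inr j) ∧ m = edgeVec i j ∧
    (Sum.inl i ∈ F ↔ Sum.inr j ∈ F) ∧ (Sum.inl i ∈ F' ↔ Sum.inr j ∈ F')}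
  have hS : S ⊆ dualEdgeCone G := by
    rintro _ ⟨i, j, hij, rfl, -⟩
    exact edgeVec_mem hij
  have hmem : vec F ∈ dualFace G S := by
    refine (mem_dualFace_iff G).2 ⟨vec_mem_edgeCone hF.up, ?_⟩
    rintro _ ⟨i, j, hij, rfl, h, -⟩
    exact pairing_edgeVec_vec_eq_zero_iff.2 h
  have hmem' : vec F' ∈ dualFace G S := by
    refine (mem_dualFace_iff G).2 ⟨vec_mem_edgeCone hF'.up, ?_⟩
    rintro _ ⟨i, j, hij, rfl, -, h⟩
    exact pairing_edgeVec_vec_eq_zero_iff.2 h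
  have hgen' : ∀ x, ofPot U₁ U₂ x ∈ dualFace G S → ∃ c α β : ℚ, 0 ≤ α ∧ 0 ≤ β ∧
      ∀ v, x v = α * F.indicator 1 v + β * F'.indicator 1 v + c := by
    intro x hx
    rw [mem_dualFace_iff] at hx
    have key : ∀ i j, G.Adj (Sum.inl i) (Sum.inr j) → (Sum.inl i ∈ F ↔ Sum.inr j ∈ F) →
        (Sum.inl i ∈ F' ↔ Sum.inr j ∈ F') → x (Sum.inl i) = x (Sum.inr j) := by
      intro i j hij h h'
      have := hx.2 _ ⟨i, j, hij, rfl, h, h'⟩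
      rwa [pairing_edgeVec_ofPot, sub_eq_zero] at this
    refine hgen x hx.1 fun v w hvw h h' => ?_
    rcases adj_cases hG hvw with ⟨i, j, rfl, rfl⟩ | ⟨i, j, rfl, rfl⟩
    · exact key i j hvw h h'
    · exact (key i j hvw.symm h.symm h'.symm).symm
  have hind : LinearIndependent ℚ ![vec F, vec F'] := by
    rw [LinearIndependent.pair_iff]
    intro a b hab
    rw [vec, vec, ← map_smul, ← map_smul, ← map_add, ofPot_eq_zero_iff] at hab
    obtain ⟨c, hc⟩ := hab
    have h1 := hc p
    have h2 := hc p'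
    have h3 := hc k
    by_cases hkF : k ∈ F
    · simp [hp.1, hp.2, hp'.1, hp'.2, hkF, hk.1 hkF] at h1 h2 h3
      constructor <;> linarith
    · have hkF' : k ∉ F' := fun h => hkF (hk.2 h)
      simp [hp.1, hp.2, hp'.1, hp'.2, hkF, hkF'] at h1 h2 h3
      constructor <;> linarith
  have hspan : Submodule.span ℚ (dualFace G S : Set (NSpace U₁ U₂)) =
      Submodule.span ℚ (range ![vec F, vec F']) := by
    apply le_antisymm
    · rw [Submodule.span_le]
      intro n hn
      obtain ⟨x, rfl⟩ := ofPot_surjective n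
      obtain ⟨c, α, β, -, -, hx⟩ := hgen' x hn
      have h1 : ofPot U₁ U₂ x = α • vec F + β • vec F' := by
        rw [vec, vec, ← map_smul, ← map_smul, ← map_add, ofPot_eq_iff]
        exact ⟨c, fun v => by simp [hx v]⟩
      rw [h1]
      exact Submodule.add_mem _ (Submodule.smul_mem _ _ (Submodule.subset_span ⟨0, rfl⟩))
        (Submodule.smul_mem _ _ (Submodule.subset_span ⟨1, rfl⟩))
    · apply Submodule.span_mono
      rintro _ ⟨k, rfl⟩
      fin_cases k
      · exact hmem
      · exact hmem'
  have hdim : coneDim (dualFace G S) = 2 := by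
    rw [coneDim, hspan, finrank_span_eq_card hind, Fintype.card_fin]
  have h := formsFace_toggle hG hconn (F := ![F, F']) (τ := dualFace G S) (d := 2) ?_
    (Fin.forall_fin_two.2 ⟨hF, hF'⟩) (Fin.forall_fin_two.2 ⟨hne, hne'⟩)
    (dualFace_isFaceOf G hS) hdim (Fin.forall_fin_two.2 ⟨hmem, hmem'⟩) ?_
  · refine ⟨dualFace G S, ?_⟩
    convert h using 1
    exact funext (Fin.forall_fin_two.2 ⟨rfl, rfl⟩)
  · have hFF' : F ≠ F' := fun h => hp.2 (h ▸ hp.1)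
    intro a b hab
    fin_cases a <;> fin_cases b <;> simp_all
  · intro x hx
    obtain ⟨c, α, β, hα, hβ, hxv⟩ := hgen' x hx
    exact ⟨c, ![α, β], Fin.forall_fin_two.2 ⟨hα, hβ⟩, fun v => by
      rw [hxv v, Fin.sum_univ_two]
      rfl⟩

/-- Potentials have three values, on `F`, `F'` and the rest. Connectedness of `F'ᶜ` forces an edge
from `F` to the rest, so the value on `F` is the larger; likewise for `F'`. The two differences are
the coefficients. -/
lemma memFaceTuples_of_disjoint (hG : G ≤ completeBipartiteGraph U₁ U₂) (hconn : G.Connected)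
    {F F' : Set (U₁ ⊕ U₂)} (hF : IsSplit G F) (hF' : IsSplit G F')
    (hne : (toggle F).Nonempty) (hne' : (toggle F').Nonempty) (hd : Disjoint F F')
    (hK : IsConnSet G (F ∪ F')ᶜ) : MemFaceTuples G 2 ![toggle F, toggle F'] := by
  rw [Set.disjoint_left] at hd
  obtain ⟨p, hp⟩ := hF.conn.1
  obtain ⟨p', hp'⟩ := hF'.conn.1
  obtain ⟨k, hk⟩ := hK.1
  have hk' := hk
  simp only [mem_compl_iff, mem_union, not_or] at hk'
  refine memFaceTuples_pair hG hconn hF hF' hne hne' (p := p) (p' := p') (k := k)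
    ⟨hp, hd hp⟩ ⟨hp', fun h => hd h hp'⟩ (by tauto) fun x hx hadj => ?_
  have e1 : ∀ v ∈ F, x v = x p := fun v hv => hF.conn.eq_of_forall_adj
    (fun a ha b hb hab => hadj a b hab (by tauto) (by have := hd ha; have := hd hb; tauto)) hv hp
  have e2 : ∀ v ∈ F', x v = x p' := fun v hv => hF'.conn.eq_of_forall_adj
    (fun a ha b hb hab => hadj a b hab (by have := @hd a; have := @hd b; tauto) (by tauto)) hv hp'
  have e3 : ∀ v ∈ (F ∪ F')ᶜ, x v = x k := fun v hv => hK.eq_of_forall_adj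
    (fun a ha b hb hab => by
      simp only [mem_compl_iff, mem_union, not_or] at ha hb
      exact hadj a b hab (by tauto) (by tauto)) hv hk
  obtain ⟨v, hv, w, hw, hvw⟩ := hF'.conn_compl.exists_adj (A := F) (fun v hv => hd hv) ⟨p, hp⟩
    ⟨k, hk'.2, hk'.1⟩
  obtain ⟨v', hv', w', hw', hvw'⟩ := hF.conn_compl.exists_adj (A := F') (fun v hv h => hd h hv)
    ⟨p', hp'⟩ ⟨k, hk'.1, hk'.2⟩
  have i1 := hF.le_of_adj hG hx hvw.symm hw.2 hv
  have i2 := hF'.le_of_adj hG hx hvw'.symm hw'.2 hv'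
  rw [e1 v hv, e3 w (by simpa using ⟨hw.2, hw.1⟩)] at i1
  rw [e2 v' hv', e3 w' (by simpa using ⟨hw'.1, hw'.2⟩)] at i2
  refine ⟨x k, x p - x k, x p' - x k, sub_nonneg.2 i1, sub_nonneg.2 i2, fun u => ?_⟩
  by_cases hu : u ∈ F
  · simp [hu, hd hu, e1 u hu]
  · by_cases hu' : u ∈ F'
    · simp [hu, hu', e2 u hu']
    · simp [hu, hu', e3 u (by simpa using ⟨hu, hu'⟩)]

/-- The dual argument: the blocks are `Fᶜ`, `F'ᶜ` and `F ∩ F'`, and the value on the intersection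
dominates the other two. -/
lemma memFaceTuples_of_union_eq_univ (hG : G ≤ completeBipartiteGraph U₁ U₂)
    (hconn : G.Connected) {F F' : Set (U₁ ⊕ U₂)} (hF : IsSplit G F) (hF' : IsSplit G F')
    (hne : (toggle F).Nonempty) (hne' : (toggle F').Nonempty) (hd : F ∪ F' = univ)
    (hK : IsConnSet G (F ∩ F')) : MemFaceTuples G 2 ![toggle F, toggle F'] := by
  have hd' : ∀ v, v ∉ F → v ∈ F' := fun v hv => (hd.symm ▸ mem_univ v : v ∈ F ∪ F').resolve_left hv
  obtain ⟨p, hp⟩ := hF'.conn_compl.1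
  obtain ⟨p', hp'⟩ := hF.conn_compl.1
  obtain ⟨k, hk⟩ := hK.1
  have hpF : p ∈ F := by_contra fun h => hp (hd' p h)
  refine memFaceTuples_pair hG hconn hF hF' hne hne' (p := p) (p' := p') (k := k)
    ⟨hpF, hp⟩ ⟨hd' p' hp', hp'⟩ ⟨fun _ => hk.2, fun _ => hk.1⟩ fun x hx hadj => ?_
  have e1 : ∀ v ∉ F', x v = x p := fun v hv => hF'.conn_compl.eq_of_forall_adj
    (fun a ha b hb hab => by
      rw [mem_compl_iff] at ha hb
      exact hadj a b hab (by have := hd' a; have := hd' b; tauto) (by tauto)) hv hp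
  have e2 : ∀ v ∉ F, x v = x p' := fun v hv => hF.conn_compl.eq_of_forall_adj
    (fun a ha b hb hab => by
      rw [mem_compl_iff] at ha hb
      exact hadj a b hab (by tauto) (by have := hd' a; have := hd' b; tauto)) hv hp'
  have e3 : ∀ v ∈ F ∩ F', x v = x k := fun v hv => hK.eq_of_forall_adj
    (fun a ha b hb hab => hadj a b hab ⟨fun _ => hb.1, fun _ => ha.1⟩
      ⟨fun _ => hb.2, fun _ => ha.2⟩) hv hk
  obtain ⟨v, hv, w, hw, hvw⟩ := hF'.conn.exists_adj (A := F ∩ F') inter_subset_right ⟨k, hk⟩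
    ⟨p', hd' p' hp', fun h => hp' h.1⟩
  obtain ⟨v', hv', w', hw', hvw'⟩ := hF.conn.exists_adj (A := F ∩ F') inter_subset_left ⟨k, hk⟩
    ⟨p, hpF, fun h => hp h.2⟩
  have hwF : w ∉ F := fun h => hw.2 ⟨h, hw.1⟩
  have hwF' : w' ∉ F' := fun h => hw'.2 ⟨hw'.1, h⟩
  have i1 := hF.le_of_adj hG hx hvw.symm hwF hv.1
  have i2 := hF'.le_of_adj hG hx hvw'.symm hwF' hv'.2
  rw [e2 w hwF, e3 v hv] at i1
  rw [e1 w' hwF', e3 v' hv'] at i2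
  refine ⟨x p + x p' - x k, x k - x p', x k - x p, sub_nonneg.2 i1, sub_nonneg.2 i2, fun u => ?_⟩
  by_cases hu : u ∈ F
  · by_cases hu' : u ∈ F'
    · simp [hu, hu', e3 u ⟨hu, hu'⟩]
      ring
    · simp [hu, hu', e1 u hu']
  · simp [hu, hd' u hu, e2 u hu]

end FacePairs

/-! ### Connectedness of the four blocks of a three-dimensional face. -/

section ThreeFaces

variable {U₁ U₂ : Type*} {G : SimpleGraph (U₁ ⊕ U₂)} {τ : PointedCone ℚ (NSpace U₁ U₂)}

lemma mem_iff_of_tightGraph_adj {F : Set (U₁ ⊕ U₂)} (hF : vec F ∈ τ) {v w : U₁ ⊕ U₂}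
    (h : (tightGraph G τ).Adj v w) : v ∈ F ↔ w ∈ F := by
  classical
  have := h.2 _ hF
  rw [Set.indicator_apply, Set.indicator_apply] at this
  split_ifs at this <;> simp_all

lemma IsConnSet.eq_of_mem {S : Set (U₁ ⊕ U₂)} (h : IsConnSet (tightGraph G τ) S)
    {x : U₁ ⊕ U₂ → ℚ} (hx : ofPot U₁ U₂ x ∈ τ) {v w : U₁ ⊕ U₂} (hv : v ∈ S) (hw : w ∈ S) :
    x v = x w :=
  h.eq_of_forall_adj (fun _ _ _ _ hab => hab.2 x hx) hv hw

variable [Fintype U₁] [Fintype U₂]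

/-- For a three-dimensional face, the parts of a partition into four parts which are closed under
the tight edges are connected. -/
lemma isConnSet_tightGraph_of_coneDim_eq_three (hτ : τ.IsFaceOf (edgeCone G))
    (hdim : coneDim τ = 3) {A B K : Set (U₁ ⊕ U₂)}
    (hA : A.Nonempty) (hB : B.Nonempty) (hK : K.Nonempty) (hrest : ∃ v, v ∉ A ∧ v ∉ B ∧ v ∉ K)
    (hAB : Disjoint A B) (hAK : Disjoint A K) (hBK : Disjoint B K)
    (hcl : ∀ v w, (tightGraph G τ).Adj v w →
      (v ∈ A ↔ w ∈ A) ∧ (v ∈ B ↔ w ∈ B) ∧ (v ∈ K ↔ w ∈ K)) :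
    IsConnSet (tightGraph G τ) A := by
  classical
  by_contra hc
  obtain ⟨P, Q, ⟨p, hp⟩, ⟨q, hq⟩, hPQ, rfl, hadj⟩ := exists_split_of_not_isConnSet hA hc
  obtain ⟨b, hb⟩ := hB
  obtain ⟨k, hk⟩ := hK
  obtain ⟨r, hr, hrB, hrK⟩ := hrest
  rw [Set.disjoint_right] at hAB hAK hBK hPQ
  simp only [mem_union, not_or] at hAB hAK hr hcl
  -- Splitting `A` produces five classes closed under tight edges, whereas dimension three permits
  -- only `3 + 1`.
  let c : U₁ ⊕ U₂ → Fin 5 := fun v =>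
    if v ∈ P then 0 else if v ∈ Q then 1 else if v ∈ B then 2 else if v ∈ K then 3 else 4
  have hsurj : Function.Surjective c := by
    intro y
    fin_cases y
    · exact ⟨p, by simp [c, hp]⟩
    · exact ⟨q, by simp [c, hq, hPQ hq]⟩
    · exact ⟨b, by simp [c, hb, hAB hb]⟩
    · exact ⟨k, by simp [c, hk, hAK hk, hBK hk]⟩
    · exact ⟨r, by simp [c, hr, hrB, hrK]⟩
  have := le_coneDim_add_one hτ hsurj fun v w hvw => by
    obtain ⟨h1, h2, h3⟩ := hcl v w hvw
    have h4 : v ∈ P → w ∉ Q := fun hv hw => hadj v hv w hw hvw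
    have h5 : w ∈ P → v ∉ Q := fun hv hw => hadj w hv v hw hvw.symm
    have h8 : v ∈ P ↔ w ∈ P := ⟨fun hv => (h1.1 (Or.inl hv)).resolve_right (h4 hv),
      fun hw => (h1.2 (Or.inl hw)).resolve_right (h5 hw)⟩
    have h9 : v ∈ Q ↔ w ∈ Q := ⟨fun hv => (h1.1 (Or.inr hv)).resolve_left fun hw => h5 hw hv,
      fun hw => (h1.2 (Or.inr hw)).resolve_left fun hv => h4 hv hw⟩
    simp only [c, h8, h9, h2, h3]
  omega

end ThreeFaces

/-! ### New up-sets from disjoint or covering pairs. -/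

section Splits

variable {U₁ U₂ : Type*} {G : SimpleGraph (U₁ ⊕ U₂)} {F F' : Set (U₁ ⊕ U₂)}

lemma IsSplit.exists_eq_of_adj (hG : G ≤ completeBipartiteGraph U₁ U₂) (h : IsSplit G F)
    {v w : U₁ ⊕ U₂} (hvw : G.Adj v w) (hv : v ∉ F) (hw : w ∈ F) :
    ∃ i j, v = Sum.inr j ∧ w = Sum.inl i := by
  rcases adj_cases hG hvw with ⟨i, j, rfl, rfl⟩ | h'
  · exact absurd (h.up i j hvw hw) hv
  · exact h'

/-- An edge between `F` and `Fᶜ` has its `U₁` end in `F`, the wrong direction for `Fᶜ` to be an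
up-set. Hence disjoint pairs do not cover and covering pairs are not disjoint. -/
lemma IsSplit.not_isSplit_compl (hG : G ≤ completeBipartiteGraph U₁ U₂) (hconn : G.Connected)
    (h : IsSplit G F) (h' : IsSplit G Fᶜ) : False := by
  obtain ⟨v, hv, w, hw, hvw⟩ := h.exists_adj hconn
  obtain ⟨i, j, rfl, rfl⟩ := h.exists_eq_of_adj hG hvw hv hw
  exact h'.up i j hvw.symm hv hw

lemma IsSplit.union_nonempty_compl (hG : G ≤ completeBipartiteGraph U₁ U₂) (hconn : G.Connected)
    (hF : IsSplit G F) (hF' : IsSplit G F') (hd : Disjoint F F') : (F ∪ F')ᶜ.Nonempty := by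
  by_contra hc
  rw [not_nonempty_iff_eq_empty, compl_empty_iff] at hc
  have h : F' = Fᶜ := (IsCompl.of_eq hd.eq_bot hc).compl_eq.symm
  exact hF.not_isSplit_compl hG hconn (h ▸ hF')

lemma IsSplit.inter_nonempty (hG : G ≤ completeBipartiteGraph U₁ U₂) (hconn : G.Connected)
    (hF : IsSplit G F) (hF' : IsSplit G F') (hu : F ∪ F' = univ) : (F ∩ F').Nonempty := by
  by_contra hc
  rw [not_nonempty_iff_eq_empty] at hc
  have h : F' = Fᶜ := (IsCompl.of_eq hc hu).compl_eq.symm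
  exact hF.not_isSplit_compl hG hconn (h ▸ hF')

/-- A component of the complement of two disjoint up-sets can be added to their union. -/
lemma IsSplit.union_union (hF : IsSplit G F) (hF' : IsSplit G F') (hd : Disjoint F F')
    {K L : Set (U₁ ⊕ U₂)} (hK : IsConnSet G K) (hL : IsConnSet G L) (hKL : Disjoint K L)
    (hU : K ∪ L = (F ∪ F')ᶜ) (hadj : ∀ v ∈ K, ∀ w ∈ L, ¬ G.Adj v w) :
    IsSplit G (F ∪ F' ∪ K) ∧ (∃ v ∈ K, ∃ w ∈ F, G.Adj v w) ∧ ∃ v ∈ K, ∃ w ∈ F', G.Adj v w := by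
  have hm : ∀ v, v ∈ K ∨ v ∈ L ↔ v ∉ F ∧ v ∉ F' := fun v => by
    rw [← mem_union, hU, mem_compl_iff, mem_union, not_or]
  have hL' : Lᶜ = F ∪ F' ∪ K := by
    ext v
    have := hm v
    have h1 : v ∈ K → v ∉ L := fun h => Set.disjoint_left.1 hKL h
    simp only [mem_compl_iff, mem_union]
    tauto
  have key : ∀ {F F' : Set (U₁ ⊕ U₂)}, IsSplit G F → IsSplit G F' → Disjoint F F' →
      (∀ v, v ∈ K ∨ v ∈ L ↔ v ∉ F ∧ v ∉ F') → ∃ v ∈ K, ∃ w ∈ F, G.Adj v w := by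
    intro F F' hF hF' hd hm
    obtain ⟨p, hp⟩ := hF.conn.1
    -- The connected set `F'ᶜ` is made of `F`, `K` and `L`. An edge must leave `K` inside it and
    -- cannot end in `L`, so it ends in `F`.
    obtain ⟨v, hv, w, hw, hvw⟩ := hF'.conn_compl.exists_adj (A := K)
      (fun v hv => ((hm v).1 (Or.inl hv)).2) hK.1
      ⟨p, Set.disjoint_left.1 hd hp, fun h => ((hm p).1 (Or.inl h)).1 hp⟩
    refine ⟨v, hv, w, ?_, hvw⟩
    by_contra hwF
    rcases (hm w).2 ⟨hwF, hw.1⟩ with h | h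
    · exact hw.2 h
    · exact hadj v hv w h hvw
  have h1 := key hF hF' hd hm
  have h2 := key hF' hF hd.symm fun v => (hm v).trans and_comm
  refine ⟨⟨?_, ?_, ?_⟩, h1, h2⟩
  · rintro i j hij ((hj | hj) | hj)
    · exact Or.inl (Or.inl (hF.up i j hij hj))
    · exact Or.inl (Or.inr (hF'.up i j hij hj))
    · rw [← hL']
      exact fun hi => hadj _ hj _ hi hij.symm
  · obtain ⟨v, hv, w, hw, hvw⟩ := h1
    obtain ⟨v', hv', w', hw', hvw'⟩ := h2
    have := (hF.conn.union_of_adj hK hw hv hvw.symm).union_of_adj hF'.conn (Or.inr hv') hw' hvw'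
    rwa [union_assoc, union_comm F', ← union_assoc]
  · rwa [← hL', compl_compl]

/-- A component of the intersection of two up-sets covering all vertices. -/
lemma IsSplit.of_inter (hF : IsSplit G F)
    (hF' : IsSplit G F') (hu : F ∪ F' = univ)
    {K L : Set (U₁ ⊕ U₂)} (hK : IsConnSet G K) (hL : IsConnSet G L) (hKL : Disjoint K L)
    (hU : K ∪ L = F ∩ F') (hadj : ∀ v ∈ K, ∀ w ∈ L, ¬ G.Adj v w) :
    IsSplit G K ∧ (∃ v ∈ Fᶜ, ∃ w ∈ K, G.Adj v w) ∧ ∃ v ∈ F'ᶜ, ∃ w ∈ K, G.Adj v w := by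
  have hm : ∀ v, v ∈ K ∨ v ∈ L ↔ v ∈ F ∧ v ∈ F' := fun v => by
    rw [← mem_union, hU, mem_inter_iff]
  have hcov : ∀ v, v ∈ F ∨ v ∈ F' := fun v => (hu.symm ▸ mem_univ v : v ∈ F ∪ F')
  have key : ∀ {F F' K L : Set (U₁ ⊕ U₂)}, IsSplit G F → IsSplit G F' → (∀ v, v ∈ F ∨ v ∈ F') →
      (∀ v, v ∈ K ∨ v ∈ L ↔ v ∈ F ∧ v ∈ F') → IsConnSet G K →
      (∀ v ∈ K, ∀ w ∈ L, ¬ G.Adj v w) → ∃ v ∈ Fᶜ, ∃ w ∈ K, G.Adj v w := by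
    intro F F' K L hF hF' hcov hm hK hadj
    obtain ⟨p, hp⟩ := hF.conn_compl.1
    -- Here the connected set `F'` is made of `Fᶜ`, `K` and `L`, so the edge leaving `K` ends in
    -- `Fᶜ`.
    obtain ⟨v, hv, w, hw, hvw⟩ := hF'.conn.exists_adj (A := K)
      (fun v hv => ((hm v).1 (Or.inl hv)).2) hK.1
      ⟨p, (hcov p).resolve_left hp, fun h => hp ((hm p).1 (Or.inl h)).1⟩
    refine ⟨w, ?_, v, hv, hvw.symm⟩
    by_contra hwF
    rcases (hm w).2 ⟨not_not.1 hwF, hw.1⟩ with h | h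
    · exact hw.2 h
    · exact hadj v hv w h hvw
  have hcov' : ∀ v, v ∈ F' ∨ v ∈ F := fun v => (hcov v).symm
  have hm' : ∀ v, v ∈ L ∨ v ∈ K ↔ v ∈ F ∧ v ∈ F' := fun v => or_comm.trans (hm v)
  have hadj' : ∀ v ∈ L, ∀ w ∈ K, ¬ G.Adj v w := fun v hv w hw h => hadj w hw v hv h.symm
  refine ⟨⟨?_, hK, ?_⟩, key hF hF' hcov hm hK hadj,
    key hF' hF hcov' (fun v => (hm v).trans and_comm) hK hadj⟩
  · intro i j hij hj
    have h1 := (hm _).1 (Or.inl hj)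
    refine ((hm _).2 ⟨hF.up i j hij h1.1, hF'.up i j hij h1.2⟩).resolve_right fun hi => ?_
    exact hadj _ hj _ hi hij.symm
  -- The complement of `K` is `Fᶜ ∪ L ∪ F'ᶜ`, and `L` links the two connected ends.
  · obtain ⟨v, hv, w, hw, hvw⟩ := key hF hF' hcov hm' hL hadj'
    obtain ⟨v', hv', w', hw', hvw'⟩ := key hF' hF hcov' (fun v => (hm' v).trans and_comm) hL hadj'
    have := (hF.conn_compl.union_of_adj hL hv hw hvw).union_of_adj hF'.conn_compl
      (Or.inr hw') hv' hvw'.symm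
    convert this using 1
    ext u
    have h1 := hm u
    have h2 : u ∈ K → u ∉ L := fun h => Set.disjoint_left.1 hKL h
    simp only [mem_compl_iff, mem_union]
    tauto

end Splits

/-! ### The quadrilateral of rays: crossing, disjoint and covering pairs. -/

section ThreeFaces

variable {U₁ U₂ : Type*} [Fintype U₁] [Fintype U₂] {G : SimpleGraph (U₁ ⊕ U₂)}
  {F F' : Set (U₁ ⊕ U₂)} {τ : PointedCone ℚ (NSpace U₁ U₂)}

/-- The common conclusion of the three situations. The identity `hadd` serves twice: the face
property puts `vec P` and `vec P'` into `τ`, and it shows that `P` and `P'` are opposite in the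
quadrilateral. -/
lemma formsFace_toggle_four (hG : G ≤ completeBipartiteGraph U₁ U₂) (hconn : G.Connected)
    {P P' : Set (U₁ ⊕ U₂)} (hτ : τ.IsFaceOf (edgeCone G)) (hdim : coneDim τ = 3)
    (hP : IsSplit G P) (hP' : IsSplit G P') (hF : IsSplit G F) (hF' : IsSplit G F')
    (hPne : (toggle P).Nonempty) (hPne' : (toggle P').Nonempty)
    (hFne : (toggle F).Nonempty) (hFne' : (toggle F').Nonempty)
    (h1 : P ≠ P') (h2 : P ≠ F) (h3 : P ≠ F') (h4 : P' ≠ F) (h5 : P' ≠ F') (h6 : F ≠ F')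
    (hmF : vec F ∈ τ) (hmF' : vec F' ∈ τ)
    (hadd : vec P + vec P' = vec F + vec F')
    (hgen : ∀ x, ofPot U₁ U₂ x ∈ τ → ∃ c α α' β β' : ℚ, 0 ≤ α ∧ 0 ≤ α' ∧ 0 ≤ β ∧ 0 ≤ β' ∧
      ∀ v, x v = α * P.indicator 1 v + α' * P'.indicator 1 v + β * F.indicator 1 v
        + β' * F'.indicator 1 v + c) :
    ¬ MemFaceTuples G 2 ![toggle P, toggle P'] ∧
      FormsFace G 3 ![toggle P, toggle P', toggle F, toggle F'] τ := by
  refine ⟨not_memFaceTuples_of_add_eq hG hconn hF hF' hP hP' hFne hPne hPne' hadd h2 h4, ?_⟩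
  have hsum : vec P + vec P' ∈ τ := hadd ▸ τ.add_mem hmF hmF'
  have hmP := hτ.mem_of_add_mem_left (vec_mem_edgeCone hP.up) (vec_mem_edgeCone hP'.up) hsum
  have hmP' := hτ.mem_of_add_mem_right (vec_mem_edgeCone hP.up) (vec_mem_edgeCone hP'.up) hsum
  have h := formsFace_toggle hG hconn (F := ![P, P', F, F']) (τ := τ) (d := 3) ?_
    (by simpa [Fin.forall_fin_succ] using ⟨hP, hP', hF, hF'⟩)
    (by simpa [Fin.forall_fin_succ] using ⟨hPne, hPne', hFne, hFne'⟩)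
    hτ hdim (by simpa [Fin.forall_fin_succ] using ⟨hmP, hmP', hmF, hmF'⟩) ?_
  · convert h using 1
    ext k : 1
    fin_cases k <;> rfl
  · intro a b hab
    fin_cases a <;> fin_cases b <;> first
      | rfl
      | exact (h1 hab).elim
      | exact (h1 hab.symm).elim
      | exact (h2 hab).elim
      | exact (h2 hab.symm).elim
      | exact (h3 hab).elim
      | exact (h3 hab.symm).elim
      | exact (h4 hab).elim
      | exact (h4 hab.symm).elim
      | exact (h5 hab).elim
      | exact (h5 hab.symm).elim
      | exact (h6 hab).elim
      | exact (h6 hab.symm).elim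
  · intro x hx
    obtain ⟨c, α, α', β, β', hα, hα', hβ, hβ', hxv⟩ := hgen x hx
    refine ⟨c, ![α, α', β, β'], by simpa [Fin.forall_fin_succ] using ⟨hα, hα', hβ, hβ'⟩,
      fun v => ?_⟩
    rw [hxv v, Fin.sum_univ_four]
    rfl

/-- Uncrossing: the four Boolean blocks are tight-connected, so intersection and union are again
connected with connected complements, and their indicators have the same sum as those of `F` and
`F'`. -/
lemma formsFace_of_crossing (hG : G ≤ completeBipartiteGraph U₁ U₂) (hconn : G.Connected)
    (hτ : τ.IsFaceOf (edgeCone G)) (hdim : coneDim τ = 3) (hF : IsSplit G F) (hF' : IsSplit G F')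
    (hmF : vec F ∈ τ) (hmF' : vec F' ∈ τ)
    (h₁ : (side₁ U₁ U₂ \ F).Nonempty) (h₂ : (side₂ U₁ U₂ ∩ F).Nonempty)
    (hFne' : (toggle F').Nonempty) (ha : (F ∩ F').Nonempty) (hx : (F \ F').Nonempty)
    (hy : (F' \ F).Nonempty) (hb : (F ∪ F')ᶜ.Nonempty) :
    IsConnSet G (F ∩ F') ∧ IsConnSet G (F ∪ F')ᶜ ∧
    ¬ MemFaceTuples G 2 ![toggle (F ∩ F'), toggle (F ∪ F')] ∧
      FormsFace G 3 ![toggle (F ∩ F'), toggle (F ∪ F'), toggle F, toggle F'] τ := by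
  obtain ⟨a, ha, ha'⟩ := ha
  obtain ⟨p, hp, hp'⟩ := hx
  obtain ⟨q, hq', hq⟩ := hy
  obtain ⟨b, hb⟩ := hb
  have hb' := hb
  simp only [mem_compl_iff, mem_union, not_or] at hb'
  have hcl : ∀ v w, (tightGraph G τ).Adj v w → (v ∈ F ↔ w ∈ F) ∧ (v ∈ F' ↔ w ∈ F') :=
    fun v w h => ⟨mem_iff_of_tightGraph_adj hmF h, mem_iff_of_tightGraph_adj hmF' h⟩
  have hd : ∀ {S T : Set (U₁ ⊕ U₂)}, (∀ v, v ∈ S → v ∉ T) → Disjoint S T :=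
    fun h => Set.disjoint_left.2 fun v => h v
  have ca : IsConnSet (tightGraph G τ) (F ∩ F') := by
    refine isConnSet_tightGraph_of_coneDim_eq_three hτ hdim (B := F \ F') (K := F' \ F)
      ⟨a, ha, ha'⟩ ⟨p, hp, hp'⟩ ⟨q, hq', hq⟩ ⟨b, by simp [hb']⟩ (hd fun v h h' => h'.2 h.2)
      (hd fun v h h' => h'.2 h.1) (hd fun v h h' => h'.2 h.1) fun v w h => ?_
    obtain ⟨e, e'⟩ := hcl v w h
    simp only [mem_inter_iff, mem_sdiff, e, e', and_self]
  have cp : IsConnSet (tightGraph G τ) (F \ F') := by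
    refine isConnSet_tightGraph_of_coneDim_eq_three hτ hdim (B := F ∩ F') (K := F' \ F)
      ⟨p, hp, hp'⟩ ⟨a, ha, ha'⟩ ⟨q, hq', hq⟩ ⟨b, by simp [hb']⟩ (hd fun v h h' => h.2 h'.2)
      (hd fun v h h' => h'.2 h.1) (hd fun v h h' => h'.2 h.1) fun v w h => ?_
    obtain ⟨e, e'⟩ := hcl v w h
    simp only [mem_inter_iff, mem_sdiff, e, e', and_self]
  have cq : IsConnSet (tightGraph G τ) (F' \ F) := by
    refine isConnSet_tightGraph_of_coneDim_eq_three hτ hdim (B := F ∩ F') (K := F \ F')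
      ⟨q, hq', hq⟩ ⟨a, ha, ha'⟩ ⟨p, hp, hp'⟩ ⟨b, by simp [hb']⟩ (hd fun v h h' => h.2 h'.1)
      (hd fun v h h' => h'.2 h.1) (hd fun v h h' => h'.2 h.2) fun v w h => ?_
    obtain ⟨e, e'⟩ := hcl v w h
    simp only [mem_inter_iff, mem_sdiff, e, e', and_self]
  have cb : IsConnSet (tightGraph G τ) (F ∪ F')ᶜ := by
    refine isConnSet_tightGraph_of_coneDim_eq_three hτ hdim (B := F \ F') (K := F' \ F)
      ⟨b, hb⟩ ⟨p, hp, hp'⟩ ⟨q, hq', hq⟩ ⟨a, by simp [ha, ha']⟩ (hd fun v h h' => h (Or.inl h'.1))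
      (hd fun v h h' => h (Or.inr h'.1)) (hd fun v h h' => h'.2 h.1) fun v w h => ?_
    obtain ⟨e, e'⟩ := hcl v w h
    simp only [mem_compl_iff, mem_union, mem_sdiff, e, e', and_self]
  have sa : IsSplit G (F ∩ F') := by
    refine ⟨fun i j hij hj => ⟨hF.up i j hij hj.1, hF'.up i j hij hj.2⟩,
      ca.mono (tightGraph_le τ), ?_⟩
    rw [compl_inter]
    exact hF.conn_compl.union hF'.conn_compl ⟨b, hb'⟩
  have sb : IsSplit G (F ∪ F') := by
    refine ⟨fun i j hij hj => hj.imp (hF.up i j hij) (hF'.up i j hij),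
      hF.conn.union hF'.conn ⟨a, ha, ha'⟩, cb.mono (tightGraph_le τ)⟩
  refine ⟨sa.conn, sb.conn_compl, formsFace_toggle_four hG hconn hτ hdim sa sb hF hF'
    (h₁.mono fun v hv => Or.inl ⟨hv.1, fun h => hv.2 h.1⟩)
    (h₂.mono fun v hv => Or.inr ⟨hv.1, Or.inl hv.2⟩) (h₁.mono subset_union_left) hFne'
    (fun h => hp' (h.symm ▸ Or.inl hp : p ∈ F ∩ F').2) (fun h => hp' (h.symm ▸ hp : p ∈ F ∩ F').2)
    (fun h => hq (h.symm ▸ hq' : q ∈ F ∩ F').1) (fun h => hq (h ▸ Or.inr hq'))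
    (fun h => hp' (h ▸ Or.inl hp)) (fun h => hp' (h ▸ hp)) hmF hmF' ?_ ?_⟩
  · rw [vec, vec, vec, vec, ← map_add, ← map_add, add_comm (indicator _ _),
      indicator_union_add_inter]
  · intro x hx
    have hxσ := hτ.le hx
    have ea : ∀ v ∈ F ∩ F', x v = x a := fun v hv => ca.eq_of_mem hx hv ⟨ha, ha'⟩
    have ep : ∀ v ∈ F \ F', x v = x p := fun v hv => cp.eq_of_mem hx hv ⟨hp, hp'⟩
    have eq : ∀ v ∈ F' \ F, x v = x q := fun v hv => cq.eq_of_mem hx hv ⟨hq', hq⟩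
    have eb : ∀ v ∈ (F ∪ F')ᶜ, x v = x b := fun v hv => cb.eq_of_mem hx hv hb
    have i1 : x p ≤ x a := by
      obtain ⟨v, hv, w, hw, hvw⟩ := hF.conn.exists_adj (A := F \ F') sdiff_subset ⟨p, hp, hp'⟩
        ⟨a, ha, fun h => h.2 ha'⟩
      have hw' : w ∈ F' := by_contra fun h => hw.2 ⟨hw.1, h⟩
      rw [← ep v hv, ← ea w ⟨hw.1, hw'⟩]
      exact hF'.le_of_adj hG hxσ hvw hv.2 hw'
    have i2 : x q ≤ x a := by
      obtain ⟨v, hv, w, hw, hvw⟩ := hF'.conn.exists_adj (A := F' \ F) sdiff_subset ⟨q, hq', hq⟩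
        ⟨a, ha', fun h => h.2 ha⟩
      have hw' : w ∈ F := by_contra fun h => hw.2 ⟨hw.1, h⟩
      rw [← eq v hv, ← ea w ⟨hw', hw.1⟩]
      exact hF.le_of_adj hG hxσ hvw hv.2 hw'
    have i3 : x b ≤ x q := by
      obtain ⟨v, hv, w, hw, hvw⟩ := hF.conn_compl.exists_adj (A := F' \ F) (fun v hv => hv.2)
        ⟨q, hq', hq⟩ ⟨b, hb'.1, fun h => hb'.2 h.1⟩
      have hw' : w ∉ F' := fun h => hw.2 ⟨h, hw.1⟩
      rw [← eq v hv, ← eb w fun h => h.elim hw.1 hw']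
      exact hF'.le_of_adj hG hxσ hvw.symm hw' hv.1
    have i4 : x b ≤ x p := by
      obtain ⟨v, hv, w, hw, hvw⟩ := hF'.conn_compl.exists_adj (A := F \ F') (fun v hv => hv.2)
        ⟨p, hp, hp'⟩ ⟨b, hb'.2, fun h => hb'.1 h.1⟩
      have hw' : w ∉ F := fun h => hw.2 ⟨h, hw.1⟩
      rw [← ep v hv, ← eb w fun h => h.elim hw' hw.1]
      exact hF.le_of_adj hG hxσ hvw.symm hw' hv.1
    -- `m` and `M` are the minimum and maximum of the two middle values, and `β`, `β'` their
    -- excesses over `m`, one of which is `0`. What remains is carried by the union, from `x b` up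
    -- to `m`, and the intersection, from `M` up to `x a`.
    obtain ⟨β, β', m, M, hβ, hβ', hm, hM, hpm, hqm, hpM, hqM⟩ : ∃ β β' m M : ℚ, 0 ≤ β ∧ 0 ≤ β' ∧
        x b ≤ m ∧ M ≤ x a ∧ x p = m + β ∧ x q = m + β' ∧ M = x p + β' ∧ M = x q + β := by
      rcases le_total (x p) (x q) with h | h
      · exact ⟨0, x q - x p, x p, x q, le_rfl, sub_nonneg.2 h, i4, i2, by ring, by ring, by ring,
          by ring⟩
      · exact ⟨x p - x q, 0, x q, x p, sub_nonneg.2 h, le_rfl, i3, i1, by ring, by ring, by ring,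
          by ring⟩
    refine ⟨x b, x a - M, m - x b, β, β', sub_nonneg.2 hM, sub_nonneg.2 hm, hβ, hβ', fun v => ?_⟩
    by_cases hv : v ∈ F <;> by_cases hv' : v ∈ F'
    · simp [hv, hv', ea v ⟨hv, hv'⟩]
      linarith
    · simp [hv, hv', ep v ⟨hv, hv'⟩]
      linarith
    · simp [hv, hv', eq v ⟨hv', hv⟩]
      linarith
    · simp [hv, hv', eb v fun h => h.elim hv hv']

/-- The blocks are `F`, `F'`, `K` and `L`. The new up-sets are the complements of `L` and `K`; their
indicators sum to those of `F` and `F'` plus the constant `1`. -/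
lemma formsFace_of_disjoint (hG : G ≤ completeBipartiteGraph U₁ U₂) (hconn : G.Connected)
    (hτ : τ.IsFaceOf (edgeCone G)) (hdim : coneDim τ = 3) (hF : IsSplit G F) (hF' : IsSplit G F')
    (hmF : vec F ∈ τ) (hmF' : vec F' ∈ τ) (h₂ : (side₂ U₁ U₂ ∩ F).Nonempty)
    (hFne' : (toggle F').Nonempty) (hd : Disjoint F F') (hc : ¬ IsConnSet G (F ∪ F')ᶜ) :
    ∃ K L : Set (U₁ ⊕ U₂), IsConnSet G K ∧ IsConnSet G L ∧ Disjoint K L ∧ K ∪ L = (F ∪ F')ᶜ ∧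
      IsSplit G (F ∪ F' ∪ K) ∧ IsSplit G (F ∪ F' ∪ L) ∧
      ¬ MemFaceTuples G 2 ![toggle (F ∪ F' ∪ K), toggle (F ∪ F' ∪ L)] ∧
      FormsFace G 3 ![toggle (F ∪ F' ∪ K), toggle (F ∪ F' ∪ L), toggle F, toggle F'] τ := by
  obtain ⟨K, L, hKne, hLne, hKL, hU, hadj⟩ := exists_split_of_not_isConnSet
    (hF.union_nonempty_compl hG hconn hF' hd) hc
  have hm : ∀ v, v ∈ K ∨ v ∈ L ↔ v ∉ F ∧ v ∉ F' := fun v => by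
    rw [← mem_union, hU, mem_compl_iff, mem_union, not_or]
  have hadj' : ∀ v ∈ L, ∀ w ∈ K, ¬ G.Adj v w := fun v hv w hw h => hadj w hw v hv h.symm
  have hKF : Disjoint K (F ∪ F') := Set.disjoint_left.2 fun v hv h => by
    have := (hm v).1 (Or.inl hv)
    exact h.elim this.1 this.2
  have hLF : Disjoint L (F ∪ F') := Set.disjoint_left.2 fun v hv h => by
    have := (hm v).1 (Or.inr hv)
    exact h.elim this.1 this.2
  rw [disjoint_union_right] at hKF hLF
  have hcl : ∀ v w, (tightGraph G τ).Adj v w →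
      (v ∈ F ↔ w ∈ F) ∧ (v ∈ F' ↔ w ∈ F') ∧ (v ∈ K ↔ w ∈ K) ∧ (v ∈ L ↔ w ∈ L) := by
    intro v w h
    have e := mem_iff_of_tightGraph_adj hmF h
    have e' := mem_iff_of_tightGraph_adj hmF' h
    have e3 : v ∈ K ∨ v ∈ L ↔ w ∈ K ∨ w ∈ L := by rw [hm, hm, e, e']
    have h4 : v ∈ K → w ∉ L := fun hv hw => hadj v hv w hw h.1
    have h5 : w ∈ K → v ∉ L := fun hv hw => hadj w hv v hw h.1.symm
    exact ⟨e, e', ⟨fun hv => (e3.1 (Or.inl hv)).resolve_right (h4 hv),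
      fun hw => (e3.2 (Or.inl hw)).resolve_right (h5 hw)⟩,
      ⟨fun hv => (e3.1 (Or.inr hv)).resolve_left fun hw => h5 hw hv,
      fun hw => (e3.2 (Or.inr hw)).resolve_left fun hv => h4 hv hw⟩⟩
  obtain ⟨f, hf⟩ := hF.conn.1
  obtain ⟨f', hf'⟩ := hF'.conn.1
  obtain ⟨k, hk⟩ := hKne
  obtain ⟨l, hl⟩ := hLne
  have dl := fun {S T : Set (U₁ ⊕ U₂)} (h : Disjoint S T) => @(Set.disjoint_left.1 h)
  have dr := fun {S T : Set (U₁ ⊕ U₂)} (h : Disjoint S T) => @(Set.disjoint_right.1 h)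
  have cF : IsConnSet (tightGraph G τ) F :=
    isConnSet_tightGraph_of_coneDim_eq_three hτ hdim ⟨f, hf⟩ ⟨f', hf'⟩ ⟨k, hk⟩
      ⟨l, dl hLF.1 hl, dl hLF.2 hl, dr hKL hl⟩ hd hKF.1.symm hKF.2.symm fun v w h =>
        let ⟨a, b, c, _⟩ := hcl v w h; ⟨a, b, c⟩
  have cF' : IsConnSet (tightGraph G τ) F' :=
    isConnSet_tightGraph_of_coneDim_eq_three hτ hdim ⟨f', hf'⟩ ⟨f, hf⟩ ⟨k, hk⟩
      ⟨l, dl hLF.2 hl, dl hLF.1 hl, dr hKL hl⟩ hd.symm hKF.2.symm hKF.1.symm fun v w h =>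
        let ⟨a, b, c, _⟩ := hcl v w h; ⟨b, a, c⟩
  have cK : IsConnSet (tightGraph G τ) K :=
    isConnSet_tightGraph_of_coneDim_eq_three hτ hdim ⟨k, hk⟩ ⟨f, hf⟩ ⟨f', hf'⟩
      ⟨l, dr hKL hl, dl hLF.1 hl, dl hLF.2 hl⟩ hKF.1 hKF.2 hd fun v w h =>
        let ⟨a, b, c, _⟩ := hcl v w h; ⟨c, a, b⟩
  have cL : IsConnSet (tightGraph G τ) L :=
    isConnSet_tightGraph_of_coneDim_eq_three hτ hdim ⟨l, hl⟩ ⟨f, hf⟩ ⟨f', hf'⟩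
      ⟨k, dl hKL hk, dl hKF.1 hk, dl hKF.2 hk⟩ hLF.1 hLF.2 hd fun v w h =>
        let ⟨a, b, _, c⟩ := hcl v w h; ⟨c, a, b⟩
  have gK := cK.mono (tightGraph_le τ)
  have gL := cL.mono (tightGraph_le τ)
  obtain ⟨sK, ⟨v₁, hv₁, w₁, hw₁, e₁⟩, ⟨v₂, hv₂, w₂, hw₂, e₂⟩⟩ :=
    hF.union_union hF' hd gK gL hKL hU hadj
  obtain ⟨sL, ⟨v₃, hv₃, w₃, hw₃, e₃⟩, ⟨v₄, hv₄, w₄, hw₄, e₄⟩⟩ :=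
    hF.union_union hF' hd gL gK hKL.symm (by rw [union_comm, hU]) hadj'
  have hFF' : ∀ v ∈ F, v ∉ F' := fun v hv => dl hd hv
  refine ⟨K, L, gK, gL, hKL, hU, sK, sL, formsFace_toggle_four hG hconn hτ hdim sK sL hF hF'
    (h₂.mono fun v hv => Or.inr ⟨hv.1, Or.inl (Or.inl hv.2)⟩)
    (h₂.mono fun v hv => Or.inr ⟨hv.1, Or.inl (Or.inl hv.2)⟩)
    (h₂.mono subset_union_right) hFne'
    (fun h => ?_) (fun h => dl hKF.1 hk (h ▸ Or.inr hk)) (fun h => dl hKF.2 hk (h ▸ Or.inr hk))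
    (fun h => dl hLF.1 hl (h ▸ Or.inr hl)) (fun h => dl hLF.2 hl (h ▸ Or.inr hl))
    (fun h => hFF' f hf (h ▸ hf)) hmF hmF' ?_ ?_⟩
  · rcases (h ▸ Or.inr hk : k ∈ F ∪ F' ∪ L) with (h | h) | h
    · exact dl hKF.1 hk h
    · exact dl hKF.2 hk h
    · exact dl hKL hk h
  · rw [vec, vec, vec, vec, ← map_add, ← map_add, ofPot_eq_iff]
    refine ⟨1, fun v => ?_⟩
    by_cases hv : v ∈ F
    · simp [hv, hFF' v hv]
    · by_cases hv' : v ∈ F'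
      · simp [hv, hv']
      · rcases (hm v).2 ⟨hv, hv'⟩ with h | h
        · simp [hv, hv', h, dl hKL h]
        · simp [hv, hv', h, dr hKL h]
  · intro x hx
    have hxσ := hτ.le hx
    have eF : ∀ v ∈ F, x v = x f := fun v hv => cF.eq_of_mem hx hv hf
    have eF' : ∀ v ∈ F', x v = x f' := fun v hv => cF'.eq_of_mem hx hv hf'
    have eK : ∀ v ∈ K, x v = x k := fun v hv => cK.eq_of_mem hx hv hk
    have eL : ∀ v ∈ L, x v = x l := fun v hv => cL.eq_of_mem hx hv hl
    have i1 := hF.le_of_adj hG hxσ e₁ (dl hKF.1 hv₁) hw₁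
    have i2 := hF'.le_of_adj hG hxσ e₂ (dl hKF.2 hv₂) hw₂
    have i3 := hF.le_of_adj hG hxσ e₃ (dl hLF.1 hv₃) hw₃
    have i4 := hF'.le_of_adj hG hxσ e₄ (dl hLF.2 hv₄) hw₄
    rw [eK _ hv₁, eF _ hw₁] at i1
    rw [eK _ hv₂, eF' _ hw₂] at i2
    rw [eL _ hv₃, eF _ hw₃] at i3
    rw [eL _ hv₄, eF' _ hw₄] at i4
    -- `m` is the smaller of the values on `F` and `F'`, still above those on `K` and `L`. The
    -- coefficient of each new up-set is how far its complement lies below `m`.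
    obtain ⟨β, β', m, hβ, hβ', hkm, hlm, hpm, hqm⟩ : ∃ β β' m : ℚ, 0 ≤ β ∧ 0 ≤ β' ∧
        x k ≤ m ∧ x l ≤ m ∧ x f = m + β ∧ x f' = m + β' := by
      rcases le_total (x f) (x f') with h | h
      · exact ⟨0, x f' - x f, x f, le_rfl, sub_nonneg.2 h, i1, i3, by ring, by ring⟩
      · exact ⟨x f - x f', 0, x f', sub_nonneg.2 h, le_rfl, i2, i4, by ring, by ring⟩
    refine ⟨x k + x l - m, m - x l, m - x k, β, β', sub_nonneg.2 hlm, sub_nonneg.2 hkm, hβ, hβ',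
      fun v => ?_⟩
    by_cases hv : v ∈ F
    · simp [hv, hFF' v hv, eF v hv]
      linarith
    · by_cases hv' : v ∈ F'
      · simp [hv, hv', eF' v hv']
        linarith
      · rcases (hm v).2 ⟨hv, hv'⟩ with h | h
        · simp [hv, hv', h, dl hKL h, eK v h]
        · simp [hv, hv', h, dr hKL h, eL v h]

/-- Dual to the disjoint case: the pieces `K` and `L` of the intersection are themselves the new
up-sets, and the indicators now differ by the constant `-1`. -/
lemma formsFace_of_union_eq_univ (hG : G ≤ completeBipartiteGraph U₁ U₂) (hconn : G.Connected)
    (hτ : τ.IsFaceOf (edgeCone G)) (hdim : coneDim τ = 3) (hF : IsSplit G F) (hF' : IsSplit G F')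
    (hmF : vec F ∈ τ) (hmF' : vec F' ∈ τ) (h₁ : (side₁ U₁ U₂ \ F).Nonempty)
    (hFne' : (toggle F').Nonempty) (hu : F ∪ F' = univ) (hc : ¬ IsConnSet G (F ∩ F')) :
    ∃ K L : Set (U₁ ⊕ U₂), IsConnSet G K ∧ IsConnSet G L ∧ K ∪ L = F ∩ F' ∧
      ¬ MemFaceTuples G 2 ![toggle K, toggle L] ∧
      FormsFace G 3 ![toggle K, toggle L, toggle F, toggle F'] τ := by
  obtain ⟨K, L, hKne, hLne, hKL, hU, hadj⟩ := exists_split_of_not_isConnSet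
    (hF.inter_nonempty hG hconn hF' hu) hc
  have hm : ∀ v, v ∈ K ∨ v ∈ L ↔ v ∈ F ∧ v ∈ F' := fun v => by
    rw [← mem_union, hU, mem_inter_iff]
  have hcov : ∀ v, v ∉ F → v ∈ F' := fun v =>
    (hu.symm ▸ mem_univ v : v ∈ F ∪ F').resolve_left
  have hadj' : ∀ v ∈ L, ∀ w ∈ K, ¬ G.Adj v w := fun v hv w hw h => hadj w hw v hv h.symm
  have hd : Disjoint Fᶜ F'ᶜ := Set.disjoint_left.2 fun v hv hv' => hv' (hcov v hv)
  have hKF : Disjoint K Fᶜ := Set.disjoint_left.2 fun v hv h => h ((hm v).1 (Or.inl hv)).1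
  have hKF' : Disjoint K F'ᶜ := Set.disjoint_left.2 fun v hv h => h ((hm v).1 (Or.inl hv)).2
  have hLF : Disjoint L Fᶜ := Set.disjoint_left.2 fun v hv h => h ((hm v).1 (Or.inr hv)).1
  have hLF' : Disjoint L F'ᶜ := Set.disjoint_left.2 fun v hv h => h ((hm v).1 (Or.inr hv)).2
  have hcl : ∀ v w, (tightGraph G τ).Adj v w →
      (v ∈ Fᶜ ↔ w ∈ Fᶜ) ∧ (v ∈ F'ᶜ ↔ w ∈ F'ᶜ) ∧ (v ∈ K ↔ w ∈ K) ∧ (v ∈ L ↔ w ∈ L) := by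
    intro v w h
    have e := mem_iff_of_tightGraph_adj hmF h
    have e' := mem_iff_of_tightGraph_adj hmF' h
    have e3 : v ∈ K ∨ v ∈ L ↔ w ∈ K ∨ w ∈ L := by rw [hm, hm, e, e']
    have h4 : v ∈ K → w ∉ L := fun hv hw => hadj v hv w hw h.1
    have h5 : w ∈ K → v ∉ L := fun hv hw => hadj w hv v hw h.1.symm
    exact ⟨not_congr e, not_congr e', ⟨fun hv => (e3.1 (Or.inl hv)).resolve_right (h4 hv),
      fun hw => (e3.2 (Or.inl hw)).resolve_right (h5 hw)⟩,
      ⟨fun hv => (e3.1 (Or.inr hv)).resolve_left fun hw => h5 hw hv,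
      fun hw => (e3.2 (Or.inr hw)).resolve_left fun hv => h4 hv hw⟩⟩
  obtain ⟨f, hf⟩ := hF.conn_compl.1
  obtain ⟨f', hf'⟩ := hF'.conn_compl.1
  obtain ⟨k, hk⟩ := hKne
  obtain ⟨l, hl⟩ := hLne
  have dl := fun {S T : Set (U₁ ⊕ U₂)} (h : Disjoint S T) => @(Set.disjoint_left.1 h)
  have dr := fun {S T : Set (U₁ ⊕ U₂)} (h : Disjoint S T) => @(Set.disjoint_right.1 h)
  have cF : IsConnSet (tightGraph G τ) Fᶜ :=
    isConnSet_tightGraph_of_coneDim_eq_three hτ hdim ⟨f, hf⟩ ⟨f', hf'⟩ ⟨k, hk⟩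
      ⟨l, dl hLF hl, dl hLF' hl, dr hKL hl⟩ hd hKF.symm hKF'.symm fun v w h =>
        let ⟨a, b, c, _⟩ := hcl v w h; ⟨a, b, c⟩
  have cF' : IsConnSet (tightGraph G τ) F'ᶜ :=
    isConnSet_tightGraph_of_coneDim_eq_three hτ hdim ⟨f', hf'⟩ ⟨f, hf⟩ ⟨k, hk⟩
      ⟨l, dl hLF' hl, dl hLF hl, dr hKL hl⟩ hd.symm hKF'.symm hKF.symm fun v w h =>
        let ⟨a, b, c, _⟩ := hcl v w h; ⟨b, a, c⟩
  have cK : IsConnSet (tightGraph G τ) K :=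
    isConnSet_tightGraph_of_coneDim_eq_three hτ hdim ⟨k, hk⟩ ⟨f, hf⟩ ⟨f', hf'⟩
      ⟨l, dr hKL hl, dl hLF hl, dl hLF' hl⟩ hKF hKF' hd fun v w h =>
        let ⟨a, b, c, _⟩ := hcl v w h; ⟨c, a, b⟩
  have cL : IsConnSet (tightGraph G τ) L :=
    isConnSet_tightGraph_of_coneDim_eq_three hτ hdim ⟨l, hl⟩ ⟨f, hf⟩ ⟨f', hf'⟩
      ⟨k, dl hKL hk, dl hKF hk, dl hKF' hk⟩ hLF hLF' hd fun v w h =>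
        let ⟨a, b, _, c⟩ := hcl v w h; ⟨c, a, b⟩
  have gK := cK.mono (tightGraph_le τ)
  have gL := cL.mono (tightGraph_le τ)
  obtain ⟨sK, ⟨v₁, hv₁, w₁, hw₁, e₁⟩, ⟨v₂, hv₂, w₂, hw₂, e₂⟩⟩ :=
    hF.of_inter hF' hu gK gL hKL hU hadj
  obtain ⟨sL, ⟨v₃, hv₃, w₃, hw₃, e₃⟩, ⟨v₄, hv₄, w₄, hw₄, e₄⟩⟩ :=
    hF.of_inter hF' hu gL gK hKL.symm (by rw [union_comm, hU]) hadj'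
  have hlF := (hm l).1 (Or.inr hl)
  have hkF := (hm k).1 (Or.inl hk)
  have hKsub : ∀ v ∈ K, v ∈ F ∧ v ∈ F' := fun v hv => (hm v).1 (Or.inl hv)
  have hLsub : ∀ v ∈ L, v ∈ F ∧ v ∈ F' := fun v hv => (hm v).1 (Or.inr hv)
  refine ⟨K, L, gK, gL, hU, formsFace_toggle_four hG hconn hτ hdim sK sL hF hF'
    (h₁.mono fun v hv => Or.inl ⟨hv.1, fun h => hv.2 (hKsub v h).1⟩)
    (h₁.mono fun v hv => Or.inl ⟨hv.1, fun h => hv.2 (hLsub v h).1⟩)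
    (h₁.mono subset_union_left) hFne'
    (fun h => dl hKL hk (h ▸ hk)) (fun h => dr hKL hl (h ▸ hlF.1))
    (fun h => dr hKL hl (h ▸ hlF.2)) (fun h => dl hKL hk (h ▸ hkF.1))
    (fun h => dl hKL hk (h ▸ hkF.2)) (fun h => hf (h ▸ hcov f hf)) hmF hmF' ?_ ?_⟩
  · rw [vec, vec, vec, vec, ← map_add, ← map_add, ofPot_eq_iff]
    refine ⟨-1, fun v => ?_⟩
    by_cases hv : v ∈ K
    · simp [hv, dl hKL hv, hKsub v hv]
    · by_cases hv' : v ∈ L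
      · simp [hv, hv', hLsub v hv']
      · by_cases h : v ∈ F
        · have h' : v ∉ F' := fun h' => ((hm v).2 ⟨h, h'⟩).elim hv hv'
          simp [hv, hv', h, h']
        · simp [hv, hv', h, hcov v h]
  · intro x hx
    have hxσ := hτ.le hx
    have eF : ∀ v ∈ Fᶜ, x v = x f := fun v hv => cF.eq_of_mem hx hv hf
    have eF' : ∀ v ∈ F'ᶜ, x v = x f' := fun v hv => cF'.eq_of_mem hx hv hf'
    have eK : ∀ v ∈ K, x v = x k := fun v hv => cK.eq_of_mem hx hv hk
    have eL : ∀ v ∈ L, x v = x l := fun v hv => cL.eq_of_mem hx hv hl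
    have i1 := hF.le_of_adj hG hxσ e₁ hv₁ (hKsub _ hw₁).1
    have i2 := hF'.le_of_adj hG hxσ e₂ hv₂ (hKsub _ hw₂).2
    have i3 := hF.le_of_adj hG hxσ e₃ hv₃ (hLsub _ hw₃).1
    have i4 := hF'.le_of_adj hG hxσ e₄ hv₄ (hLsub _ hw₄).2
    rw [eF _ hv₁, eK _ hw₁] at i1
    rw [eF' _ hv₂, eK _ hw₂] at i2
    rw [eF _ hv₃, eL _ hw₃] at i3
    rw [eF' _ hv₄, eL _ hw₄] at i4
    -- `M` is the larger of the values on `Fᶜ` and `F'ᶜ`; the values on `K` and `L` exceed it by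
    -- their coefficients.
    obtain ⟨β, β', M, hβ, hβ', hkM, hlM, hpM, hqM⟩ : ∃ β β' M : ℚ, 0 ≤ β ∧ 0 ≤ β' ∧
        M ≤ x k ∧ M ≤ x l ∧ x f = M - β ∧ x f' = M - β' := by
      rcases le_total (x f) (x f') with h | h
      · exact ⟨x f' - x f, 0, x f', sub_nonneg.2 h, le_rfl, i2, i4, by ring, by ring⟩
      · exact ⟨0, x f - x f', x f, le_rfl, sub_nonneg.2 h, i1, i3, by ring, by ring⟩
    refine ⟨M - β - β', x k - M, x l - M, β, β', sub_nonneg.2 hkM, sub_nonneg.2 hlM, hβ, hβ',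
      fun v => ?_⟩
    by_cases hv : v ∈ K
    · simp [hv, dl hKL hv, hKsub v hv, eK v hv]
    · by_cases hv' : v ∈ L
      · simp [hv, hv', hLsub v hv', eL v hv']
      · by_cases h : v ∈ F
        · have h' : v ∉ F' := fun h' => ((hm v).2 ⟨h, h'⟩).elim hv hv'
          simp [hv, hv', h, h', eF' v h', hqM]
          ring
        · simp [hv, hv', h, hcov v h, eF v h, hpM]

end ThreeFaces

/-! ### Reading off the types (ii), (iii) and (v). -/

section Types

variable {U₁ U₂ : Type*}

variable [Fintype U₁] [Fintype U₂] {G : SimpleGraph (U₁ ⊕ U₂)} {F F' : Set (U₁ ⊕ U₂)}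
  {τ : PointedCone ℚ (NSpace U₁ U₂)}

lemma FormsFace.reorder {d t : ℕ} {I J : Fin t → Set (U₁ ⊕ U₂)} (h : FormsFace G d I τ)
    {e : Fin t → Fin t} (he : Function.Bijective e) (hJ : ∀ k, J k = I (e k)) :
    FormsFace G d J τ := by
  have : J = I ∘ Equiv.ofBijective e he := funext hJ
  rw [this]
  exact h.comp_equiv _

/-- Hypotheses on two up-sets whose independent sets are two-sided and whose rays lie on a
three-dimensional face without spanning a two-dimensional one. -/
structure IsFacePair (G : SimpleGraph (U₁ ⊕ U₂)) (τ : PointedCone ℚ (NSpace U₁ U₂))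
    (F F' : Set (U₁ ⊕ U₂)) : Prop where
  le_bip : G ≤ completeBipartiteGraph U₁ U₂
  connected : G.Connected
  isFaceOf : τ.IsFaceOf (edgeCone G)
  dim : coneDim τ = 3
  split : IsSplit G F
  split' : IsSplit G F'
  mem : vec F ∈ τ
  mem' : vec F' ∈ τ
  ne₁ : ∃ i, Sum.inl i ∉ F
  ne₂ : ∃ j, Sum.inr j ∈ F
  ne₁' : ∃ i, Sum.inl i ∉ F'
  ne₂' : ∃ j, Sum.inr j ∈ F'
  not_mem : ¬ MemFaceTuples G 2 ![toggle F, toggle F']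

namespace IsFacePair

variable (h : IsFacePair G τ F F')
include h

lemma side₁_nonempty : (side₁ U₁ U₂ \ F).Nonempty :=
  let ⟨i, hi⟩ := h.ne₁; ⟨Sum.inl i, inl_mem_side₁ i, hi⟩

lemma side₂_nonempty : (side₂ U₁ U₂ ∩ F).Nonempty :=
  let ⟨j, hj⟩ := h.ne₂; ⟨Sum.inr j, inr_mem_side₂ j, hj⟩

lemma toggle_nonempty : (toggle F).Nonempty := h.side₁_nonempty.mono subset_union_left

lemma toggle_nonempty' : (toggle F').Nonempty :=
  let ⟨i, hi⟩ := h.ne₁'; ⟨Sum.inl i, inl_mem_toggle.2 hi⟩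

lemma of_crossing (ha : (F ∩ F').Nonempty) (hx : (F \ F').Nonempty) (hy : (F' \ F).Nonempty)
    (hb : (F ∪ F')ᶜ.Nonempty) :
    IsConnSet G (F ∩ F') ∧ IsConnSet G (F ∪ F')ᶜ ∧
    ¬ MemFaceTuples G 2 ![toggle (F ∩ F'), toggle (F ∪ F')] ∧
      FormsFace G 3 ![toggle (F ∩ F'), toggle (F ∪ F'), toggle F, toggle F'] τ :=
  formsFace_of_crossing h.le_bip h.connected h.isFaceOf h.dim h.split h.split' h.mem h.mem'
    h.side₁_nonempty h.side₂_nonempty h.toggle_nonempty' ha hx hy hb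

lemma of_disjoint (hd : Disjoint F F') :
    ∃ K L : Set (U₁ ⊕ U₂), IsConnSet G K ∧ IsConnSet G L ∧ Disjoint K L ∧ K ∪ L = (F ∪ F')ᶜ ∧
      IsSplit G (F ∪ F' ∪ K) ∧ IsSplit G (F ∪ F' ∪ L) ∧
      ¬ MemFaceTuples G 2 ![toggle (F ∪ F' ∪ K), toggle (F ∪ F' ∪ L)] ∧
      FormsFace G 3 ![toggle (F ∪ F' ∪ K), toggle (F ∪ F' ∪ L), toggle F, toggle F'] τ :=
  formsFace_of_disjoint h.le_bip h.connected h.isFaceOf h.dim h.split h.split' h.mem h.mem'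
    h.side₂_nonempty h.toggle_nonempty' hd fun hK => h.not_mem
      (memFaceTuples_of_disjoint h.le_bip h.connected h.split h.split' h.toggle_nonempty
        h.toggle_nonempty' hd hK)

lemma of_union_eq_univ (hu : F ∪ F' = univ) :
    ∃ K L : Set (U₁ ⊕ U₂), IsConnSet G K ∧ IsConnSet G L ∧ K ∪ L = F ∩ F' ∧
      ¬ MemFaceTuples G 2 ![toggle K, toggle L] ∧
      FormsFace G 3 ![toggle K, toggle L, toggle F, toggle F'] τ :=
  formsFace_of_union_eq_univ h.le_bip h.connected h.isFaceOf h.dim h.split h.split' h.mem h.mem'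
    h.side₁_nonempty h.toggle_nonempty' hu fun hK => h.not_mem
      (memFaceTuples_of_union_eq_univ h.le_bip h.connected h.split h.split' h.toggle_nonempty
        h.toggle_nonempty' hu hK)

/-- The hypothesis puts `F ∩ F'` inside `U₁` and `(F ∪ F')ᶜ` inside `U₂`, so their connected pieces
are single vertices. If both are nonempty the pair crosses, giving `a` and `b`; a covering pair
gives `a` and `a'`, a disjoint one `b` and `b'`. -/
lemma typeII (hII : TypeII (toggle F) (toggle F')) :
    (∃ a a' : U₁, ¬ MemFaceTuples G 2 ![coSingle₁ U₂ a, coSingle₁ U₂ a'] ∧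
      part₁ (toggle F) ∪ part₁ (toggle F') = coSingle₁ U₂ a ∩ coSingle₁ U₂ a' ∧
      part₂ (toggle F) ∪ part₂ (toggle F') = side₂ U₁ U₂ ∧
      FormsFace G 3 ![coSingle₁ U₂ a, coSingle₁ U₂ a', toggle F, toggle F'] τ) ∨
    (∃ b b' : U₂, ¬ MemFaceTuples G 2 ![coSingle₂ U₁ b, coSingle₂ U₁ b'] ∧
      part₁ (toggle F) ∪ part₁ (toggle F') = side₁ U₁ U₂ ∧
      part₂ (toggle F) ∪ part₂ (toggle F') = coSingle₂ U₁ b ∩ coSingle₂ U₁ b' ∧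
      FormsFace G 3 ![coSingle₂ U₁ b, coSingle₂ U₁ b', toggle F, toggle F'] τ) ∨
    (∃ (a : U₁) (b : U₂), ¬ MemFaceTuples G 2 ![coSingle₁ U₂ a, coSingle₂ U₁ b] ∧
      part₁ (toggle F) ∪ part₁ (toggle F') = coSingle₁ U₂ a ∧
      part₂ (toggle F) ∪ part₂ (toggle F') = coSingle₂ U₁ b ∧
      FormsFace G 3 ![coSingle₁ U₂ a, coSingle₂ U₁ b, toggle F, toggle F'] τ) := by
  have hI₁ : ∀ i, Sum.inl i ∉ F → Sum.inl i ∈ F' := fun i hi => by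
    by_contra hi'
    exact hII.1.subset ⟨⟨inl_mem_toggle.2 hi, inl_mem_side₁ i⟩,
      ⟨inl_mem_toggle.2 hi', inl_mem_side₁ i⟩⟩
  have hI₂ : ∀ j, Sum.inr j ∈ F → Sum.inr j ∉ F' := fun j hj hj' =>
    hII.2.subset ⟨⟨inr_mem_toggle.2 hj, inr_mem_side₂ j⟩, ⟨inr_mem_toggle.2 hj', inr_mem_side₂ j⟩⟩
  simp only [part₁_toggle, part₂_toggle]
  by_cases ha : (F ∩ F').Nonempty
  · by_cases hb : (F ∪ F')ᶜ.Nonempty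
    · right; right
      obtain ⟨j, hj⟩ := h.ne₂
      obtain ⟨j', hj'⟩ := h.ne₂'
      obtain ⟨ca, cb, hn, hf⟩ := h.of_crossing ha ⟨_, hj, hI₂ j hj⟩
        ⟨_, hj', fun h => hI₂ j' h hj'⟩ hb
      obtain ⟨a, ha⟩ := ca.exists_eq_singleton_inl h.le_bip fun j hj => hI₂ j hj.1 hj.2
      obtain ⟨b, hb⟩ := cb.exists_eq_singleton_inr h.le_bip
        fun i hi => hi (by by_cases hF : Sum.inl i ∈ F; exacts [Or.inl hF, Or.inr (hI₁ i hF)])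
      have hb' : F ∪ F' = {Sum.inr b}ᶜ := by rw [← hb, compl_compl]
      rw [ha, hb', toggle_singleton_inl, toggle_compl_singleton_inr] at hn hf
      refine ⟨a, b, hn, ?_, ?_, hf⟩
      · rw [← sdiff_inter, ha, coSingle₁]
      · rw [← inter_union_distrib_left, hb', coSingle₂, sdiff_eq]
    · left
      rw [not_nonempty_iff_eq_empty, compl_empty_iff] at hb
      obtain ⟨K, L, cK, cL, hU, hn, hf⟩ := h.of_union_eq_univ hb
      obtain ⟨a, rfl⟩ := cK.exists_eq_singleton_inl h.le_bip fun j hj =>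
        hI₂ j (hU.subset (Or.inl hj)).1 (hU.subset (Or.inl hj)).2
      obtain ⟨a', rfl⟩ := cL.exists_eq_singleton_inl h.le_bip fun j hj =>
        hI₂ j (hU.subset (Or.inr hj)).1 (hU.subset (Or.inr hj)).2
      rw [toggle_singleton_inl, toggle_singleton_inl] at hn hf
      refine ⟨a, a', hn, ?_, ?_, hf⟩
      · rw [← sdiff_inter, ← hU, coSingle₁, coSingle₁, sdiff_inter_sdiff]
      · rw [← inter_union_distrib_left, hb, inter_univ]
  · right; left
    rw [not_nonempty_iff_eq_empty] at ha
    obtain ⟨K, L, cK, cL, hKL, hU, -, -, hn, hf⟩ := h.of_disjoint (disjoint_iff_inter_eq_empty.2 ha)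
    have hI : ∀ i, Sum.inl i ∉ (F ∪ F')ᶜ := fun i hi =>
      hi (by by_cases hF : Sum.inl i ∈ F; exacts [Or.inl hF, Or.inr (hI₁ i hF)])
    obtain ⟨b, rfl⟩ := cK.exists_eq_singleton_inr h.le_bip fun i hi =>
      hI i (hU.subset (Or.inl hi))
    obtain ⟨b', rfl⟩ := cL.exists_eq_singleton_inr h.le_bip fun i hi =>
      hI i (hU.subset (Or.inr hi))
    have hU' : F ∪ F' = ({Sum.inr b} ∪ {Sum.inr b'})ᶜ := by rw [hU, compl_compl]
    have hbb : b ≠ b' := fun h => Set.disjoint_left.1 hKL rfl (by rw [h]; rfl)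
    have e1 : F ∪ F' ∪ {Sum.inr b} = {Sum.inr b'}ᶜ := by
      rw [hU']
      ext v
      simp only [mem_union, mem_compl_iff, mem_singleton_iff]
      grind
    have e2 : F ∪ F' ∪ {Sum.inr b'} = {Sum.inr b}ᶜ := by
      rw [hU']
      ext v
      simp only [mem_union, mem_compl_iff, mem_singleton_iff]
      grind
    rw [e1, e2, toggle_compl_singleton_inr, toggle_compl_singleton_inr] at hn hf
    refine ⟨b', b, hn, ?_, ?_, hf⟩
    · rw [← sdiff_inter, ha, sdiff_empty]
    · rw [← inter_union_distrib_left, hU', coSingle₂, coSingle₂, sdiff_inter_sdiff, sdiff_eq,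
        union_comm]

/-- Now `F ∩ F'` lies in `U₁` and some vertex of `U₁` is outside `F ∪ F'`. A nonempty intersection
means crossing, and it is the single vertex `a`. Otherwise the pair is disjoint: both `K` and `L`
may meet `U₁`, which gives two two-sided sets, or one of them is a single `b`. -/
lemma typeIII (hIII : TypeIII (toggle F) (toggle F')) :
    (∃ (a : U₁) (A C'' : Set (U₁ ⊕ U₂)),
      A = part₁ (toggle F) ∪ part₁ (toggle F') ∧ A = coSingle₁ U₂ a ∧
      C'' = (part₁ (toggle F) ∩ part₁ (toggle F')) ∪ (part₂ (toggle F) ∪ part₂ (toggle F')) ∧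
      FormsFace G 3 ![A, toggle F, toggle F', C''] τ) ∨
    (∃ D D' : Set (U₁ ⊕ U₂),
      part₁ (toggle F) ∪ part₁ (toggle F') = side₁ U₁ U₂ ∧
      IsTwoSided G D ∧ IsTwoSided G D' ∧ Disjoint (part₁ D) (part₁ D') ∧
      part₁ D ∪ part₁ D' = part₁ (toggle F) ∩ part₁ (toggle F') ∧
      part₂ D ∩ part₂ D' = part₂ (toggle F) ∪ part₂ (toggle F') ∧
      part₂ D ∪ part₂ D' = side₂ U₁ U₂ ∧
      FormsFace G 3 ![toggle F, toggle F', D, D'] τ) ∨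
    (∃ (b : U₂) (C'' : Set (U₁ ⊕ U₂)),
      part₁ (toggle F) ∪ part₁ (toggle F') = side₁ U₁ U₂ ∧
      Sum.inr b ∉ part₂ (toggle F) ∪ part₂ (toggle F') ∧
      C'' = (part₁ (toggle F) ∩ part₁ (toggle F')) ∪
        (part₂ (toggle F) ∪ part₂ (toggle F')) ∪ {Sum.inr b} ∧
      FormsFace G 3 ![coSingle₂ U₁ b, toggle F, toggle F', C''] τ) := by
  have hI₂ : ∀ j, Sum.inr j ∈ F → Sum.inr j ∉ F' := fun j hj hj' =>
    hIII.2.subset ⟨⟨inr_mem_toggle.2 hj, inr_mem_side₂ j⟩,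
      ⟨inr_mem_toggle.2 hj', inr_mem_side₂ j⟩⟩
  obtain ⟨w, hw⟩ := nonempty_iff_ne_empty.2 hIII.1
  simp only [part₁_toggle, part₂_toggle] at hw ⊢
  by_cases ha : (F ∩ F').Nonempty
  · left
    obtain ⟨j, hj⟩ := h.ne₂
    obtain ⟨j', hj'⟩ := h.ne₂'
    obtain ⟨ca, -, -, hf⟩ := h.of_crossing ha ⟨_, hj, hI₂ j hj⟩
      ⟨_, hj', fun h => hI₂ j' h hj'⟩ ⟨w, fun h => h.elim hw.1.2 hw.2.2⟩
    obtain ⟨a, ha⟩ := ca.exists_eq_singleton_inl h.le_bip fun j hj => hI₂ j hj.1 hj.2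
    rw [ha, toggle_singleton_inl] at hf
    refine ⟨a, coSingle₁ U₂ a, toggle (F ∪ F'), ?_, rfl, ?_,
      hf.reorder (e := ![0, 2, 3, 1]) (by decide) fun k => by fin_cases k <;> rfl⟩
    · rw [← sdiff_inter, ha, coSingle₁]
    · ext (i | j) <;> simp
  · right
    rw [not_nonempty_iff_eq_empty] at ha
    have hU₁ : side₁ U₁ U₂ \ F ∪ side₁ U₁ U₂ \ F' = side₁ U₁ U₂ := by
      rw [← sdiff_inter, ha, sdiff_empty]
    obtain ⟨K, L, cK, cL, hKL, hU, sK, sL, hn, hf⟩ :=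
      h.of_disjoint (disjoint_iff_inter_eq_empty.2 ha)
    rw [Set.disjoint_left] at hKL
    have hm : ∀ v, v ∈ K ∨ v ∈ L ↔ v ∉ F ∧ v ∉ F' := fun v => by
      rw [← mem_union, hU, mem_compl_iff, mem_union, not_or]
    by_cases hK : ∃ i, Sum.inl i ∈ K
    · by_cases hL : ∃ i, Sum.inl i ∈ L
      · left
        obtain ⟨j, hj⟩ := h.ne₂
        obtain ⟨i, hi⟩ := hK
        obtain ⟨i', hi'⟩ := hL
        have hi₁ := (hm _).1 (Or.inl hi)
        have hi₂ := (hm _).1 (Or.inr hi')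
        refine ⟨toggle (F ∪ F' ∪ K), toggle (F ∪ F' ∪ L), hU₁,
          sK.isTwoSided h.le_bip h.connected ⟨_, inl_mem_side₁ i', ?_⟩
            ⟨_, inr_mem_side₂ j, Or.inl (Or.inl hj)⟩,
          sL.isTwoSided h.le_bip h.connected ⟨_, inl_mem_side₁ i, ?_⟩
            ⟨_, inr_mem_side₂ j, Or.inl (Or.inl hj)⟩, ?_, ?_, ?_, ?_,
          hf.reorder (e := ![2, 3, 0, 1]) (by decide) fun k => by fin_cases k <;> rfl⟩
        · rintro ((h | h) | h)
          · exact hi₂.1 h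
          · exact hi₂.2 h
          · exact hKL h hi'
        · rintro ((h | h) | h)
          · exact hi₁.1 h
          · exact hi₁.2 h
          · exact hKL hi h
        · rw [Set.disjoint_left, part₁_toggle, part₁_toggle]
          rintro v ⟨-, hv⟩ ⟨-, hv'⟩
          simp only [mem_union, not_or] at hv hv'
          exact ((hm v).2 hv.1).elim hv.2 hv'.2
        · rw [part₁_toggle, part₁_toggle]
          ext v
          have := hm v
          have := @hKL v
          simp only [mem_union, mem_inter_iff, mem_sdiff]
          tauto
        · rw [part₂_toggle, part₂_toggle]
          ext v
          have := hm v
          have := @hKL v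
          simp only [mem_union, mem_inter_iff]
          tauto
        · rw [part₂_toggle, part₂_toggle]
          ext v
          have := hm v
          simp only [mem_union, mem_inter_iff]
          tauto
      · right
        obtain ⟨b, rfl⟩ := cL.exists_eq_singleton_inr h.le_bip fun i hi => hL ⟨i, hi⟩
        have hb := (hm _).1 (Or.inr rfl)
        -- The one-sided set comes from adjoining the component other than `{b}`; adjoining `b`
        -- itself gives `C''`.
        have e : F ∪ F' ∪ K = {Sum.inr b}ᶜ := by
          ext v
          have := hm v
          have := @hKL v
          simp only [mem_union, mem_compl_iff, mem_singleton_iff] at *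
          tauto
        rw [e, toggle_compl_singleton_inr] at hf
        refine ⟨b, toggle (F ∪ F' ∪ {Sum.inr b}), hU₁, fun hc => hc.elim (fun h => hb.1 h.2)
          fun h => hb.2 h.2, ?_, hf.reorder (e := ![0, 2, 3, 1]) (by decide)
          fun k => by fin_cases k <;> rfl⟩
        ext (i | j) <;> simp [or_comm]
    · right
      obtain ⟨b, rfl⟩ := cK.exists_eq_singleton_inr h.le_bip fun i hi => hK ⟨i, hi⟩
      have hb := (hm _).1 (Or.inl rfl)
      have e : F ∪ F' ∪ L = {Sum.inr b}ᶜ := by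
        ext v
        have := hm v
        have := @hKL v
        simp only [mem_union, mem_compl_iff, mem_singleton_iff] at *
        tauto
      rw [e, toggle_compl_singleton_inr] at hf
      refine ⟨b, toggle (F ∪ F' ∪ {Sum.inr b}), hU₁, fun hc => hc.elim (fun h => hb.1 h.2)
        fun h => hb.2 h.2, ?_, hf.reorder (e := ![1, 2, 3, 0]) (by decide)
        fun k => by fin_cases k <;> rfl⟩
      ext (i | j) <;> simp [or_comm]

/-- The pair crosses: incomparable `U₂` parts make both differences nonempty, a common vertex of the
`U₂` parts lies in `F ∩ F'`, and a common vertex of the `U₁` parts lies outside `F ∪ F'`. -/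
lemma typeV (hV : TypeV (toggle F) (toggle F')) :
    FormsFace G 3 ![toggle F, toggle F',
      (part₁ (toggle F) ∩ part₁ (toggle F')) ∪ (part₂ (toggle F) ∪ part₂ (toggle F')),
      (part₁ (toggle F) ∪ part₁ (toggle F')) ∪ (part₂ (toggle F) ∩ part₂ (toggle F'))] τ := by
  obtain ⟨⟨h1, h2, h3⟩, ⟨h4, h5, h6⟩⟩ := hV
  simp only [part₁_toggle, part₂_toggle] at *
  have hx : (F \ F').Nonempty := by
    by_contra hc
    rw [not_nonempty_iff_eq_empty, sdiff_eq_empty] at hc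
    exact h5 (inter_eq_left.2 (inter_subset_inter_right _ hc))
  have hy : (F' \ F).Nonempty := by
    by_contra hc
    rw [not_nonempty_iff_eq_empty, sdiff_eq_empty] at hc
    exact h6 (inter_eq_right.2 (inter_subset_inter_right _ hc))
  obtain ⟨v, hv⟩ := nonempty_iff_ne_empty.2 h4
  obtain ⟨w, hw⟩ := nonempty_iff_ne_empty.2 h1
  obtain ⟨-, -, -, hf⟩ := h.of_crossing ⟨v, hv.1.2, hv.2.2⟩ hx hy
    ⟨w, fun h => h.elim hw.1.2 hw.2.2⟩
  refine hf.reorder (e := ![2, 3, 1, 0]) (by decide) fun k => ?_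
  fin_cases k
  · rfl
  · rfl
  · change _ = toggle (F ∪ F')
    ext (i | j) <;> simp
  · change _ = toggle (F ∩ F')
    ext (i | j) <;> simp [imp_iff_not_or]

end IsFacePair

end Types

end EdgeCone

end

theorem mainTheorem11 {U₁ U₂ : Type*} [Fintype U₁] [Fintype U₂]
    (G : SimpleGraph (U₁ ⊕ U₂)) (hG : G ≤ completeBipartiteGraph U₁ U₂) (hconn : G.Connected)
    (C C' : Set (U₁ ⊕ U₂))
    (hC : EdgeCone.IsFirst G C) (hC2 : EdgeCone.IsTwoSided G C)
    (hC' : EdgeCone.IsFirst G C') (hC2' : EdgeCone.IsTwoSided G C')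
    (hpair : ¬ EdgeCone.MemFaceTuples G 2 ![C, C'])
    (τ : PointedCone ℚ (EdgeCone.NSpace U₁ U₂))
    (hτ : τ.IsFaceOf (EdgeCone.edgeCone G)) (hdim : EdgeCone.coneDim τ = 3)
    (hray : EdgeCone.ray G C ∈ EdgeCone.extremalRays τ)
    (hray' : EdgeCone.ray G C' ∈ EdgeCone.extremalRays τ) :
    (EdgeCone.TypeII C C' →
      (∃ a a' : U₁,
        ¬ EdgeCone.MemFaceTuples G 2 ![EdgeCone.coSingle₁ U₂ a, EdgeCone.coSingle₁ U₂ a'] ∧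
        EdgeCone.part₁ C ∪ EdgeCone.part₁ C' =
          EdgeCone.coSingle₁ U₂ a ∩ EdgeCone.coSingle₁ U₂ a' ∧
        EdgeCone.part₂ C ∪ EdgeCone.part₂ C' = EdgeCone.side₂ U₁ U₂ ∧
        EdgeCone.FormsFace G 3
          ![EdgeCone.coSingle₁ U₂ a, EdgeCone.coSingle₁ U₂ a', C, C'] τ) ∨
      (∃ b b' : U₂,
        ¬ EdgeCone.MemFaceTuples G 2 ![EdgeCone.coSingle₂ U₁ b, EdgeCone.coSingle₂ U₁ b'] ∧
        EdgeCone.part₁ C ∪ EdgeCone.part₁ C' = EdgeCone.side₁ U₁ U₂ ∧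
        EdgeCone.part₂ C ∪ EdgeCone.part₂ C' =
          EdgeCone.coSingle₂ U₁ b ∩ EdgeCone.coSingle₂ U₁ b' ∧
        EdgeCone.FormsFace G 3
          ![EdgeCone.coSingle₂ U₁ b, EdgeCone.coSingle₂ U₁ b', C, C'] τ) ∨
      (∃ (a : U₁) (b : U₂),
        ¬ EdgeCone.MemFaceTuples G 2 ![EdgeCone.coSingle₁ U₂ a, EdgeCone.coSingle₂ U₁ b] ∧
        EdgeCone.part₁ C ∪ EdgeCone.part₁ C' = EdgeCone.coSingle₁ U₂ a ∧
        EdgeCone.part₂ C ∪ EdgeCone.part₂ C' = EdgeCone.coSingle₂ U₁ b ∧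
        EdgeCone.FormsFace G 3
          ![EdgeCone.coSingle₁ U₂ a, EdgeCone.coSingle₂ U₁ b, C, C'] τ)) ∧
    (EdgeCone.TypeIII C C' →
      (∃ (a : U₁) (A C'' : Set (U₁ ⊕ U₂)),
        A = EdgeCone.part₁ C ∪ EdgeCone.part₁ C' ∧ A = EdgeCone.coSingle₁ U₂ a ∧
        C'' = (EdgeCone.part₁ C ∩ EdgeCone.part₁ C') ∪
          (EdgeCone.part₂ C ∪ EdgeCone.part₂ C') ∧
        EdgeCone.FormsFace G 3 ![A, C, C', C''] τ) ∨
      (∃ D D' : Set (U₁ ⊕ U₂),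
        EdgeCone.part₁ C ∪ EdgeCone.part₁ C' = EdgeCone.side₁ U₁ U₂ ∧
        EdgeCone.IsTwoSided G D ∧ EdgeCone.IsTwoSided G D' ∧
        Disjoint (EdgeCone.part₁ D) (EdgeCone.part₁ D') ∧
        EdgeCone.part₁ D ∪ EdgeCone.part₁ D' = EdgeCone.part₁ C ∩ EdgeCone.part₁ C' ∧
        EdgeCone.part₂ D ∩ EdgeCone.part₂ D' = EdgeCone.part₂ C ∪ EdgeCone.part₂ C' ∧
        EdgeCone.part₂ D ∪ EdgeCone.part₂ D' = EdgeCone.side₂ U₁ U₂ ∧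
        EdgeCone.FormsFace G 3 ![C, C', D, D'] τ) ∨
      (∃ (b : U₂) (C'' : Set (U₁ ⊕ U₂)),
        EdgeCone.part₁ C ∪ EdgeCone.part₁ C' = EdgeCone.side₁ U₁ U₂ ∧
        Sum.inr b ∉ EdgeCone.part₂ C ∪ EdgeCone.part₂ C' ∧
        C'' = (EdgeCone.part₁ C ∩ EdgeCone.part₁ C') ∪
          (EdgeCone.part₂ C ∪ EdgeCone.part₂ C') ∪ {Sum.inr b} ∧
        EdgeCone.FormsFace G 3 ![EdgeCone.coSingle₂ U₁ b, C, C', C''] τ)) ∧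
    (EdgeCone.TypeV C C' →
      EdgeCone.FormsFace G 3
        ![C, C',
          (EdgeCone.part₁ C ∩ EdgeCone.part₁ C') ∪ (EdgeCone.part₂ C ∪ EdgeCone.part₂ C'),
          (EdgeCone.part₁ C ∪ EdgeCone.part₁ C') ∪ (EdgeCone.part₂ C ∩ EdgeCone.part₂ C')]
        τ) := by
  have hF := hC.isSplit hG hC2
  have hF' := hC'.isSplit hG hC2'
  obtain ⟨F, rfl⟩ : ∃ F, C = EdgeCone.toggle F := ⟨_, (EdgeCone.toggle_toggle C).symm⟩
  obtain ⟨F', rfl⟩ : ∃ F', C' = EdgeCone.toggle F' := ⟨_, (EdgeCone.toggle_toggle C').symm⟩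
  rw [EdgeCone.toggle_toggle] at hF hF'
  have h : EdgeCone.IsFacePair G τ F F' := by
    obtain ⟨hne, ⟨_, hi, ⟨i, rfl⟩⟩, -, ⟨_, hj, ⟨j, rfl⟩⟩, -⟩ := hC2
    obtain ⟨hne', ⟨_, hi', ⟨i', rfl⟩⟩, -, ⟨_, hj', ⟨j', rfl⟩⟩, -⟩ := hC2'
    exact ⟨hG, hconn, hτ, hdim, hF, hF',
      hray.1.le (EdgeCone.vec_mem_ray hG hconn hF hne.1),
      hray'.1.le (EdgeCone.vec_mem_ray hG hconn hF' hne'.1),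
      ⟨i, EdgeCone.inl_mem_toggle.1 hi⟩, ⟨j, EdgeCone.inr_mem_toggle.1 hj⟩,
      ⟨i', EdgeCone.inl_mem_toggle.1 hi'⟩, ⟨j', EdgeCone.inr_mem_toggle.1 hj'⟩, hpair⟩
  exact ⟨h.typeII, h.typeIII, h.typeV⟩
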